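/- \textbf{Theorem (Formula for a region of type C).} \emph{Lattice and weights.} Consider the triangular lattice with coordinates $(i,j)$ such that one unit of the horizontal $i$-axis is half the length of a lattice edge, one unit of the vertical $j$-axis is the height of a unit triangle, and the origin is a lattice vertex. A lozenge is the union of two unit triangles that share an edge; it is vertical if the shared edge is horizontal. Under the weight $\mathrm{wt}_2$, a vertical lozenge with center $(i,j)$ has weight $\frac{q^{i}+q^{-i}}{2}$ if $i\neq 0$, a vertical lozenge centered on the $j$-axis ($i=0$) has weight $\frac12$, and every other lozenge has weight $1$. For a finite region $R$, $\mathrm M(R)$ is the sum, over all lozenge tilings of $R$, of the product of the weights of the lozenges of the tiling (so $\mathrm M(\emptyset)=1$). \emph{The region.} Let $x,u,n$ be non-negative integers with $n\le u$, and let $1\le h_1<h_2<\dots<h_n\le u$ be integers. Start with the halved hexagon whose north, northeast, southeast and south sides have lengths $x,\ 2u-n,\ n,\ x+u-n$ and whose west side is the vertical zigzag with $2u$ unit steps $(0,0),(-1,1),(0,2),(-1,3),\dots,(-1,2u-1),(0,2u)$; its southwest corner is the origin, so the $j$-axis passes through the centers of the vertical lozenges along the west side. For $1\le k\le u$ the $k$-th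 bump of the west side (counted from the bottom) has its tip at $(-1,2k-1)$. For every $k\in\{1,\dots,u\}\setminus\{h_1,\dots,h_n\}$ remove from the region the up-pointing unit triangle in the $k$-th bump, i.e. the one with vertices $(-1,2k-1),(1,2k-1),(0,2k)$. The resulting region, weighted by $\mathrm{wt}_2$, is $C_{x,u}(h_1,\dots,h_n)$. \emph{The product.} Put $[k]_q=1+q+\dots+q^{k-1}$, $[k]_q!=[1]_q[2]_q\cdots[k]_q$, $\left\langle{b\atop a}\right\rangle=a+(a+1)+\dots+b$ and $f(t,a,b)=\frac{ab(2t+a-b)}{2}$. For an integer $x$, non-negative integers $u,d,m,n$ with $m\le d$, $n\le u$, and sequences $1\le l_1<\dots<l_m\le d$, $1\le h_1<\dots<h_n\le u$, let $e'=\min(u-n,\,d-m+1)$, $\tilde x=x+u-n+d-m-e'$, $t_1'=2(x+u-n-e')+1$, $t_2'=2(x+d-m+1-e')$, \[E'=f(t_1'+2d-m,\,n+1,\,m)+\sum_{i=1}^m\left\langle{t_1'+2d-m-(m-i+1)\atop t_1'+2(d-l_i)-2(m-i)}\right\rangle+\sum_{i=1}^n\left\langle{t_2'+2u-n-(n-i+1)\atop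 t_2'+2(u-h_i)-2(n-i)}\right\rangle,\] \[F'=(n+1)m+\sum_{i=1}^m(2l_i-i)+\sum_{i=1}^n(2h_i-i),\] and \begin{align*} Q(x,u,d,(l_i)_{i=1}^m,(h_j)_{j=1}^n)={}&2^{-F'}q^{-E'}\,\frac{\prod_{1\le i<j\le m}[2(l_j-l_i)]_{q^2}\prod_{1\le i<j\le n}[2(h_j-h_i)]_{q^2}}{\prod_{i=1}^m\prod_{j=1}^n[2(l_i+h_j)]_{q^2}\prod_{i=1}^m[2l_i]_{q^2}!\prod_{j=1}^n[2h_j-1]_{q^2}!}\\ &\times\prod_{i=1}^{\lceil n/2\rceil}\prod_{j=1}^{2n-4i+3}[2\tilde x+2i+j]_{q^2}\\ &\times\prod_{i=1}^m[2(\tilde x+n+i)]_{q^2}[2(\tilde x+n+i+1)]_{q^2}\prod_{i=1}^m\prod_{j=1}^{n+i-1}[2\tilde x+n+i+j+1]_{q^2}\\ &\times\prod_{i=1}^n\prod_{j=1}^m\frac{[2(\tilde x+i+j-1)]_{q^2}}{[2(\tilde x+i+j-1)+1]_{q^2}}\\ &\times\prod_{i=1}^m\prod_{j=1}^{l_i-i}[2(\tilde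 x+i+j+n+1)]_{q^2}[2(\tilde x-i-j+m+1)]_{q^2}\\ &\times\prod_{i=1}^n\prod_{j=1}^{h_i-i}[2(\tilde x+i+j+m)]_{q^2}[2(\tilde x-i-j+n+2)]_{q^2}. \end{align*} \emph{Claim.} Let $q$ be an indeterminate or, more generally, a nonzero element of a field in which $2\neq0$ and $[k]_{q^2}\ne 0$ for all $k\ge1$. Then \[\mathrm M(C_{x,u}(h_1,\dots,h_n))=Q(x,u,0,\emptyset,(h_j)_{j=1}^n)\quad\text{if } n<u,\] \[\mathrm M(C_{x,u}(h_1,\dots,h_n))=Q(x-1,u,0,\emptyset,(h_j)_{j=1}^n)\quad\text{if } n=u.\] (In both cases $\tilde x=x+u-n-1$ and $t_2'=2x$.) -/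

import Mathlib

/-! ## The triangular lattice

Coordinates: one unit of the horizontal `i`-axis is half an edge of the lattice, one unit of the
vertical `j`-axis is the height of a row of unit triangles, and the origin is a lattice vertex.
The lattice vertices are the points `(i, j)` of `ℤ × ℤ` with `i + j` even.  The unit triangle in
the row between heights `j` and `j + 1` whose horizontal edge has its midpoint on the vertical
line `i = c` is encoded as `(c, j)`:
* if `c + j` is odd it is up-pointing, with vertices `(c - 1, j)`, `(c + 1, j)`, `(c, j + 1)`;
* if `c + j` is even it is down-pointing, with vertices `(c - 1, j + 1)`, `(c + 1, j + 1)`,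
  `(c, j)`. -/

/-- Unit triangles of the triangular lattice. -/
abbrev UnitTriangle : Type := ℤ × ℤ

/-- The up-pointing unit triangles. -/
def UnitTriangle.IsUp (t : UnitTriangle) : Prop := Odd (t.1 + t.2)

instance : DecidablePred UnitTriangle.IsUp := fun t =>
  inferInstanceAs (Decidable (Odd (t.1 + t.2)))

/-- A lozenge is the union of two unit triangles sharing an edge; it is given as the pair of its
up-pointing triangle `(c, j)` and its down-pointing triangle, which is the left neighbour
`(c - 1, j)`, the right neighbour `(c + 1, j)`, or the neighbour `(c, j - 1)` below. -/
def IsLozenge (L : UnitTriangle × UnitTriangle) : Prop :=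
  UnitTriangle.IsUp L.1 ∧
    (L.2 = (L.1.1 - 1, L.1.2) ∨ L.2 = (L.1.1 + 1, L.1.2) ∨ L.2 = (L.1.1, L.1.2 - 1))

instance : DecidablePred IsLozenge := fun L =>
  inferInstanceAs (Decidable (UnitTriangle.IsUp L.1 ∧
    (L.2 = (L.1.1 - 1, L.1.2) ∨ L.2 = (L.1.1 + 1, L.1.2) ∨ L.2 = (L.1.1, L.1.2 - 1))))

/-- The lozenges contained in a finite region (a finite set of unit triangles). -/
def regionLozenges (R : Finset UnitTriangle) : Finset (UnitTriangle × UnitTriangle) :=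
  (R ×ˢ R).filter IsLozenge

/-- The lozenge tilings of a region: sets of lozenges contained in the region such that every unit
triangle of the region belongs to exactly one of them. -/
def lozengeTilings (R : Finset UnitTriangle) : Finset (Finset (UnitTriangle × UnitTriangle)) :=
  (regionLozenges R).powerset.filter fun T =>
    ∀ t ∈ R, (T.filter fun L => L.1 = t ∨ L.2 = t).card = 1

/-- The weight `wt₂`.  A vertical lozenge, with upper triangle `(c, j)` and lower triangle
`(c, j - 1)`, has its center at the point `(c, j)`; its weight is `(q ^ c + q ^ (-c)) / 2`, except
that it is `1 / 2` if the lozenge is crossed by the `j`-axis (`c = 0`).  All other lozenges have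
weight `1`. -/
def wtTwo {K : Type*} [Field K] (q : K) (L : UnitTriangle × UnitTriangle) : K :=
  if L.2 = (L.1.1, L.1.2 - 1) then
    if L.1.1 = 0 then 1 / 2 else (q ^ L.1.1 + q ^ (-L.1.1)) / 2
  else 1

/-- The tiling generating function of a region, for the weight `wt₂`. -/
def tilingGF {K : Type*} [Field K] (q : K) (R : Finset UnitTriangle) : K :=
  ∑ T ∈ lozengeTilings R, ∏ L ∈ T, wtTwo q L

/-! ## The region -/

/-- The halved hexagon with north, northeast, southeast and south sides of lengths
`x, 2 * u - n, n, x + u - n` (for `n ≤ u`), placed with its southwest corner at the origin.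
With `s = 2 * (x + u - n)` its corners are `(0, 0)`, `(s, 0)`, `(s + n, n)`, `(2 * x, 2 * u)`,
`(0, 2 * u)`, and its west side is the vertical zigzag
`(0, 0), (-1, 1), (0, 2), (-1, 3), …, (-1, 2 * u - 1), (0, 2 * u)` with `2 * u` unit steps.
The triangles to the right of the zigzag are those with `0 ≤ c`, the first inequality of the
filter describes the southeast side, and the second one the northeast side. -/
noncomputable def halvedHexagon (x u n : ℕ) : Finset UnitTriangle :=
  (Finset.Icc (0 : ℤ) (2 * x + 2 * u) ×ˢ Finset.Ico (0 : ℤ) (2 * u)).filter fun t =>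
    t.1 ≤ 2 * ((x : ℤ) + u - n) + t.2 ∧ t.1 + t.2 + 1 ≤ 2 * ((x : ℤ) + u - n) + 2 * n

/-- The region `C_{x,u}(h₁, …, hₙ)`.  The bumps of the west side of the halved hexagon are
numbered `1, …, u` from bottom to top; the tip of bump `k` is the vertex `(-1, 2 * k - 1)` and
its up-pointing triangle is `(0, 2 * k - 1)`.  That triangle is removed for every `k` which is
not one of the `hᵢ`.  The `j`-axis goes through the centers of the vertical lozenges along the
west side. -/
noncomputable def typeCRegion (x u : ℕ) {n : ℕ} (h : Fin n → ℕ) : Finset UnitTriangle :=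
  halvedHexagon x u n \
    ((Finset.Icc 1 u).filter fun k => ∀ i, h i ≠ k).image fun k : ℕ => ((0 : ℤ), 2 * (k : ℤ) - 1)

/-! ## The product formula -/

/-- The `q`-integer `[k]_q = 1 + q + ⋯ + q ^ (k - 1)`, for an integer `k ≥ 0`. -/
def qInt {K : Type*} [Field K] (q : K) (k : ℤ) : K := ∑ i ∈ Finset.range k.toNat, q ^ i

/-- The `q`-factorial `[k]_q! = [1]_q [2]_q ⋯ [k]_q`. -/
def qFact {K : Type*} [Field K] (q : K) (k : ℕ) : K := ∏ i ∈ Finset.Icc 1 k, qInt q i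

/-- `⟨b; a⟩ = a + (a + 1) + ⋯ + b`. -/
noncomputable def consecSum (b a : ℤ) : ℤ := ∑ k ∈ Finset.Icc a b, k

/-- `f(t, a, b) = a b (2 t + a - b) / 2`, which is always an integer. -/
def fQ (t a b : ℤ) : ℤ := a * b * (2 * t + a - b) / 2

/-- `e' = min (u - n, d - m + 1)`. -/
noncomputable def eQ (u d m n : ℤ) : ℤ := min (u - n) (d - m + 1)

/-- The exponent `E'`; the index `i` of the text is `(i : ℤ) + 1` for `i` in `Fin m` or `Fin n`,
here and below. -/
noncomputable def expE (x : ℤ) (u d : ℕ) {m n : ℕ} (l : Fin m → ℕ) (h : Fin n → ℕ) : ℤ :=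
  let e := eQ u d m n
  let t₁ : ℤ := 2 * (x + u - n - e) + 1
  let t₂ : ℤ := 2 * (x + d - m + 1 - e)
  fQ (t₁ + 2 * d - m) (n + 1) m
    + ∑ i : Fin m, consecSum (t₁ + 2 * d - m - (m - ((i : ℤ) + 1) + 1))
        (t₁ + 2 * ((d : ℤ) - l i) - 2 * (m - ((i : ℤ) + 1)))
    + ∑ i : Fin n, consecSum (t₂ + 2 * u - n - (n - ((i : ℤ) + 1) + 1))
        (t₂ + 2 * ((u : ℤ) - h i) - 2 * (n - ((i : ℤ) + 1)))

/-- The exponent `F'`. -/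
def expF {m n : ℕ} (l : Fin m → ℕ) (h : Fin n → ℕ) : ℤ :=
  ((n : ℤ) + 1) * m + ∑ i : Fin m, (2 * (l i : ℤ) - ((i : ℤ) + 1))
    + ∑ i : Fin n, (2 * (h i : ℤ) - ((i : ℤ) + 1))

/-- The expression `Q(x, u, d, (lᵢ), (hⱼ))`, with `y = x + u - n + d - m - e'`. -/
noncomputable def qProductQ {K : Type*} [Field K] (q : K) (x : ℤ) (u d : ℕ) {m n : ℕ}
    (l : Fin m → ℕ) (h : Fin n → ℕ) : K :=
  let y : ℤ := x + u - n + d - m - eQ u d m n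
  let br : ℤ → K := qInt (q ^ 2)
  (2 : K) ^ (-expF l h) * q ^ (-expE x u d l h)
  * (((∏ i : Fin m, ∏ j ∈ Finset.Ioi i, br (2 * ((l j : ℤ) - l i)))
        * ∏ i : Fin n, ∏ j ∈ Finset.Ioi i, br (2 * ((h j : ℤ) - h i)))
      / ((∏ i : Fin m, ∏ j : Fin n, br (2 * ((l i : ℤ) + h j)))
        * (∏ i : Fin m, qFact (q ^ 2) (2 * l i)) * ∏ j : Fin n, qFact (q ^ 2) (2 * h j - 1)))
  * (∏ i ∈ Finset.Icc 1 ((n + 1) / 2), ∏ j ∈ Finset.Icc 1 (2 * n + 3 - 4 * i),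
      br (2 * y + 2 * i + j))
  * (∏ i ∈ Finset.Icc 1 m, br (2 * (y + n + i)) * br (2 * (y + n + i + 1)))
  * (∏ i ∈ Finset.Icc 1 m, ∏ j ∈ Finset.Icc 1 (n + i - 1), br (2 * y + n + i + j + 1))
  * (∏ i ∈ Finset.Icc 1 n, ∏ j ∈ Finset.Icc 1 m,
      br (2 * (y + i + j - 1)) / br (2 * (y + i + j - 1) + 1))
  * (∏ i : Fin m, ∏ j ∈ Finset.Icc 1 (l i - (i + 1)),
      br (2 * (y + ((i : ℤ) + 1) + j + n + 1)) * br (2 * (y - ((i : ℤ) + 1) - j + m + 1)))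
  * (∏ i : Fin n, ∏ j ∈ Finset.Icc 1 (h i - (i + 1)),
      br (2 * (y + ((i : ℤ) + 1) + j + m)) * br (2 * (y - ((i : ℤ) + 1) - j + n + 2)))

/-!
Lozenge tilings of the region correspond to families of non-intersecting lattice paths that start
along the southeast side and end at the remaining bumps of the west side.  By the lemma of
Lindström, Gessel and Viennot the tiling generating function is therefore a determinant of
generating functions of single paths.

In terms of the balanced `q`-integers `⟨k⟩ = (q ^ k - q ^ (-k)) / (q - q⁻¹)` the latter are
products.  The weight `1 / 2` on the axis is a reflection principle: the product formula, continued
to negative abscissae, is odd under `c ↦ -c - 2` whenever the number of vertical steps is odd, and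
this turns the weight `(q ^ 0 + q ^ 0) / 2 = 1` into `1 / 2`.

Since `⟨a⟩⟨b - 1⟩ - ⟨a - 1⟩⟨b⟩ = ⟨b - a⟩`, every balanced `q`-integer of a difference is an area
form of two vectors, and the determinant is an instance of an evaluation of Krattenthaler, which
reduces to the projective Vandermonde determinant.  Passing from balanced to ordinary `q`-integers
only produces a power of `q`, and the exponents balance.
-/

section Tilings

variable {A : Type*} [CommSemiring A] (w : UnitTriangle × UnitTriangle → A)
  {R : Finset UnitTriangle} {T : Finset (UnitTriangle × UnitTriangle)}
  {L : UnitTriangle × UnitTriangle}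

/-- The tiling generating function of a region for an arbitrary weight `w` on lozenges. -/
def tilingSum (w : UnitTriangle × UnitTriangle → A) (R : Finset UnitTriangle) : A :=
  ∑ T ∈ lozengeTilings R, ∏ L ∈ T, w L

theorem mem_regionLozenges :
    L ∈ regionLozenges R ↔ L.1 ∈ R ∧ L.2 ∈ R ∧ IsLozenge L := by
  simp [regionLozenges, and_assoc]

theorem mem_lozengeTilings :
    T ∈ lozengeTilings R ↔
      T ⊆ regionLozenges R ∧ ∀ t ∈ R, ∃! L, L ∈ T ∧ (L.1 = t ∨ L.2 = t) := by
  simp only [lozengeTilings, Finset.mem_filter, Finset.mem_powerset, Finset.card_eq_one]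
  refine and_congr_right fun _ => forall₂_congr fun t _ => ?_
  simp only [Finset.eq_singleton_iff_unique_mem, Finset.mem_filter, ExistsUnique]

theorem erase_mem_lozengeTilings (hT : T ∈ lozengeTilings R) (hL : L ∈ T) :
    T.erase L ∈ lozengeTilings (R \ {L.1, L.2}) := by
  rw [mem_lozengeTilings] at hT ⊢
  obtain ⟨hTR, hcover⟩ := hT
  simp only [Finset.mem_sdiff, Finset.mem_insert, Finset.mem_singleton, not_or]
  refine ⟨fun M hM => ?_, fun t ⟨htR, ht₁, ht₂⟩ => ?_⟩
  · obtain ⟨hML, hMT⟩ := Finset.mem_erase.1 hM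
    obtain ⟨hM₁, hM₂, hMloz⟩ := mem_regionLozenges.1 (hTR hMT)
    have not_covered : ∀ t ∈ R, M.1 = t ∨ M.2 = t → t ≠ L.1 ∧ t ≠ L.2 := fun t ht hMt =>
      ⟨fun e => hML ((hcover t ht).unique ⟨hMT, hMt⟩ ⟨hL, Or.inl e.symm⟩),
        fun e => hML ((hcover t ht).unique ⟨hMT, hMt⟩ ⟨hL, Or.inr e.symm⟩)⟩
    simp only [mem_regionLozenges, Finset.mem_sdiff, Finset.mem_insert, Finset.mem_singleton,
      not_or]
    exact ⟨⟨hM₁, not_covered _ hM₁ (Or.inl rfl)⟩, ⟨hM₂, not_covered _ hM₂ (Or.inr rfl)⟩, hMloz⟩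
  · obtain ⟨M, ⟨hM, hMt⟩, hunique⟩ := hcover t htR
    refine ⟨M, ⟨Finset.mem_erase.2 ⟨?_, hM⟩, hMt⟩,
      fun N hN => hunique N ⟨Finset.mem_of_mem_erase hN.1, hN.2⟩⟩
    rintro rfl
    exact hMt.elim (fun e => ht₁ e.symm) (fun e => ht₂ e.symm)

theorem notMem_of_mem_lozengeTilings_sdiff (hT : T ∈ lozengeTilings (R \ {L.1, L.2})) :
    L ∉ T := fun hL => by
  simpa using (mem_regionLozenges.1 ((mem_lozengeTilings.1 hT).1 hL)).1

theorem insert_mem_lozengeTilings (hL : L ∈ regionLozenges R)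
    (hT : T ∈ lozengeTilings (R \ {L.1, L.2})) : insert L T ∈ lozengeTilings R := by
  rw [mem_lozengeTilings] at hT ⊢
  obtain ⟨hTR, hcover⟩ := hT
  simp only [Finset.subset_iff, mem_regionLozenges, Finset.mem_sdiff, Finset.mem_insert,
    Finset.mem_singleton, not_or] at hTR hcover
  refine ⟨Finset.insert_subset hL fun M hM => mem_regionLozenges.2
    ⟨(hTR hM).1.1, (hTR hM).2.1.1, (hTR hM).2.2⟩, fun t ht => ?_⟩
  by_cases htL : L.1 = t ∨ L.2 = t
  · refine ⟨L, ⟨Finset.mem_insert_self _ _, htL⟩, fun M ⟨hM, hMt⟩ => ?_⟩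
    refine (Finset.mem_insert.1 hM).resolve_right fun hMT => ?_
    obtain ⟨⟨-, h₁₁, h₁₂⟩, ⟨-, h₂₁, h₂₂⟩, -⟩ := hTR hMT
    rcases hMt with rfl | rfl <;> grind
  · obtain ⟨M, ⟨hM, hMt⟩, hunique⟩ := hcover t (by grind)
    refine ⟨M, ⟨Finset.mem_insert_of_mem hM, hMt⟩, fun N ⟨hN, hNt⟩ => ?_⟩
    rcases Finset.mem_insert.1 hN with rfl | hN
    · exact absurd hNt htL
    · exact hunique N ⟨hN, hNt⟩

theorem sum_tilings_containing (hL : L ∈ regionLozenges R) :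
    ∑ T ∈ lozengeTilings R with L ∈ T, ∏ M ∈ T, w M = w L * tilingSum w (R \ {L.1, L.2}) := by
  rw [tilingSum, Finset.mul_sum]
  refine Finset.sum_bij' (fun T _ => T.erase L) (fun T _ => insert L T)
    (fun T hT => ?_) (fun T hT => ?_) (fun T hT => ?_) (fun T hT => ?_) (fun T hT => ?_)
  · exact erase_mem_lozengeTilings (Finset.mem_filter.1 hT).1 (Finset.mem_filter.1 hT).2
  · exact Finset.mem_filter.2 ⟨insert_mem_lozengeTilings hL hT, Finset.mem_insert_self _ _⟩
  · exact Finset.insert_erase (Finset.mem_filter.1 hT).2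
  · exact Finset.erase_insert (notMem_of_mem_lozengeTilings_sdiff hT)
  · exact (Finset.mul_prod_erase _ _ (Finset.mem_filter.1 hT).2).symm

theorem tilingSum_eq_sum_covering {t : UnitTriangle} (ht : t ∈ R) :
    tilingSum w R = ∑ L ∈ regionLozenges R with L.1 = t ∨ L.2 = t,
      w L * tilingSum w (R \ {L.1, L.2}) := by
  calc tilingSum w R
    _ = ∑ T ∈ lozengeTilings R, ∑ L ∈ regionLozenges R with L.1 = t ∨ L.2 = t,
          if L ∈ T then ∏ M ∈ T, w M else 0 := by
        refine Finset.sum_congr rfl fun T hT => ?_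
        obtain ⟨hTR, hcover⟩ := mem_lozengeTilings.1 hT
        obtain ⟨L, ⟨hL, hLt⟩, hunique⟩ := hcover t ht
        rw [Finset.sum_eq_single_of_mem L (Finset.mem_filter.2 ⟨hTR hL, hLt⟩), if_pos hL]
        exact fun M hM hML => if_neg fun hMT => hML (hunique M ⟨hMT, (Finset.mem_filter.1 hM).2⟩)
    _ = _ := by
        rw [Finset.sum_comm]
        refine Finset.sum_congr rfl fun L hL => ?_
        rw [← Finset.sum_filter, sum_tilings_containing w (Finset.mem_filter.1 hL).1]

theorem tilingSum_empty : tilingSum w ∅ = 1 := by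
  simp [tilingSum, lozengeTilings, regionLozenges]

end Tilings

section PathRegions

/-- The down-pointing triangle at the vertex `p` of the path lattice `ℤ × ℤ`.  These skew
coordinates number the triangles of each orientation without a parity condition; a lattice path
leaves `p` to the west or to the north. -/
def downTriangle (p : ℤ × ℤ) : UnitTriangle := (2 * p.1 - p.2, p.2)

/-- The up-pointing triangle at the vertex `p` of the path lattice: the right neighbour of
`downTriangle p`. -/
def upTriangle (p : ℤ × ℤ) : UnitTriangle := (2 * p.1 - p.2 + 1, p.2)

/-- The endpoint of the horizontal step of a lattice path from `p`. -/
def west (p : ℤ × ℤ) : ℤ × ℤ := (p.1 - 1, p.2)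

/-- The endpoint of the vertical step of a lattice path from `p`. -/
def north (p : ℤ × ℤ) : ℤ × ℤ := (p.1, p.2 + 1)

theorem downTriangle_injective : Function.Injective downTriangle := fun p p' h => by
  simp only [downTriangle, Prod.mk.injEq] at h
  ext <;> lia

theorem upTriangle_injective : Function.Injective upTriangle := fun p p' h => by
  simp only [upTriangle, Prod.mk.injEq] at h
  ext <;> lia

theorem downTriangle_ne_upTriangle (p p' : ℤ × ℤ) : downTriangle p ≠ upTriangle p' := fun h => by
  simp only [downTriangle, upTriangle, Prod.mk.injEq] at h
  lia

theorem exists_eq_downTriangle_or_upTriangle (t : UnitTriangle) :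
    ∃ p, t = downTriangle p ∨ t = upTriangle p := by
  obtain ⟨k, hk | hk⟩ := Int.even_or_odd' (t.1 + t.2)
  · exact ⟨(k, t.2), Or.inl (Prod.ext (by simp only [downTriangle]; lia) rfl)⟩
  · exact ⟨(k, t.2), Or.inr (Prod.ext (by simp only [upTriangle]; lia) rfl)⟩

theorem isLozenge_iff {L : UnitTriangle × UnitTriangle} :
    IsLozenge L ↔ ∃ p p', L = (upTriangle p', downTriangle p) ∧
      (p' = p ∨ p' = west p ∨ p' = north p) := by
  obtain ⟨⟨c, j⟩, ⟨c', j'⟩⟩ := L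
  simp only [IsLozenge, UnitTriangle.IsUp, upTriangle, downTriangle, west, north, Prod.mk.injEq]
  constructor
  · rintro ⟨⟨k, hk⟩, ⟨rfl, rfl⟩ | ⟨rfl, rfl⟩ | ⟨rfl, rfl⟩⟩
    · exact ⟨(k, j'), (k, j'), by lia, by simp⟩
    · exact ⟨(k + 1, j'), (k, j'), by lia, by simp⟩
    · exact ⟨(k, j - 1), (k, j), by lia, by simp⟩
  · rintro ⟨⟨a, b⟩, p', ⟨⟨rfl, rfl⟩, rfl, rfl⟩, rfl | rfl | rfl⟩
    · exact ⟨⟨a, by ring⟩, by lia⟩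
    · exact ⟨⟨a - 1, by ring⟩, by lia⟩
    · exact ⟨⟨a, by ring⟩, by lia⟩

/-- The region with down-pointing triangles at the vertices `D` and up-pointing triangles at the
vertices `U`. -/
def pathRegion (D U : Finset (ℤ × ℤ)) : Finset UnitTriangle :=
  D.image downTriangle ∪ U.image upTriangle

variable {D U : Finset (ℤ × ℤ)} {p p' v : ℤ × ℤ}

@[simp]
theorem downTriangle_mem_pathRegion : downTriangle p ∈ pathRegion D U ↔ p ∈ D := by
  simp only [pathRegion, Finset.mem_union, downTriangle_injective.mem_finset_image,
    Finset.mem_image, (downTriangle_ne_upTriangle _ _).symm, and_false, exists_false, or_false]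

@[simp]
theorem upTriangle_mem_pathRegion : upTriangle p ∈ pathRegion D U ↔ p ∈ U := by
  simp only [pathRegion, Finset.mem_union, upTriangle_injective.mem_finset_image,
    Finset.mem_image, downTriangle_ne_upTriangle, and_false, exists_false, false_or]

theorem eq_pathRegion_iff {R : Finset UnitTriangle} :
    R = pathRegion D U ↔ (∀ p, downTriangle p ∈ R ↔ p ∈ D) ∧ (∀ p, upTriangle p ∈ R ↔ p ∈ U) := by
  refine ⟨by rintro rfl; simp, fun ⟨hD, hU⟩ => Finset.ext fun t => ?_⟩
  obtain ⟨p, rfl | rfl⟩ := exists_eq_downTriangle_or_upTriangle t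
  · rw [hD, downTriangle_mem_pathRegion]
  · rw [hU, upTriangle_mem_pathRegion]

theorem pathRegion_sdiff_pair :
    pathRegion D U \ {upTriangle p', downTriangle p} = pathRegion (D.erase p) (U.erase p') := by
  rw [eq_pathRegion_iff]
  simp [downTriangle_ne_upTriangle, (downTriangle_ne_upTriangle _ _).symm,
    downTriangle_injective.eq_iff, upTriangle_injective.eq_iff, and_comm]

theorem mem_regionLozenges_pathRegion {L : UnitTriangle × UnitTriangle} :
    L ∈ regionLozenges (pathRegion D U) ↔ ∃ p ∈ D, ∃ p' ∈ U,
      L = (upTriangle p', downTriangle p) ∧ (p' = p ∨ p' = west p ∨ p' = north p) := by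
  rw [mem_regionLozenges, isLozenge_iff]
  constructor
  · rintro ⟨hU, hD, p, p', rfl, hp⟩
    exact ⟨p, downTriangle_mem_pathRegion.1 hD, p', upTriangle_mem_pathRegion.1 hU, rfl, hp⟩
  · rintro ⟨p, hD, p', hU, rfl, hp⟩
    exact ⟨upTriangle_mem_pathRegion.2 hU, downTriangle_mem_pathRegion.2 hD, p, p', rfl, hp⟩

variable {A : Type*} [CommSemiring A] (w : UnitTriangle × UnitTriangle → A)

theorem tilingSum_pathRegion_of_isolated (hD : v ∈ D) (hU : v ∈ U)
    (hv : ∀ p ∈ D, west p ≠ v ∧ north p ≠ v) :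
    tilingSum w (pathRegion D U) = w (upTriangle v, downTriangle v) *
      tilingSum w (pathRegion (D.erase v) (U.erase v)) := by
  have cover : (regionLozenges (pathRegion D U)).filter
      (fun L => L.1 = upTriangle v ∨ L.2 = upTriangle v) = {(upTriangle v, downTriangle v)} := by
    ext L
    simp only [Finset.mem_filter, mem_regionLozenges_pathRegion, Finset.mem_singleton]
    constructor
    · rintro ⟨⟨p, hp, p', -, rfl, hpp'⟩, hL⟩
      have hp'v : p' = v :=
        upTriangle_injective (hL.resolve_right (downTriangle_ne_upTriangle p v))
      obtain rfl : v = p := by grind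
      rw [hp'v]
    · rintro rfl
      exact ⟨⟨v, hD, v, hU, rfl, Or.inl rfl⟩, Or.inl rfl⟩
  rw [tilingSum_eq_sum_covering w (upTriangle_mem_pathRegion.2 hU), cover, Finset.sum_singleton,
    pathRegion_sdiff_pair]

theorem tilingSum_pathRegion_of_source (hD : v ∈ D) (hU : v ∉ U) :
    tilingSum w (pathRegion D U) =
      (if west v ∈ U then w (upTriangle (west v), downTriangle v) *
        tilingSum w (pathRegion (D.erase v) (U.erase (west v))) else 0) +
      (if north v ∈ U then w (upTriangle (north v), downTriangle v) *
        tilingSum w (pathRegion (D.erase v) (U.erase (north v))) else 0) := by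
  have cover : (regionLozenges (pathRegion D U)).filter
      (fun L => L.1 = downTriangle v ∨ L.2 = downTriangle v) =
      (({west v, north v} : Finset (ℤ × ℤ)).filter (· ∈ U)).image
        fun p' => (upTriangle p', downTriangle v) := by
    ext L
    simp only [Finset.mem_filter, mem_regionLozenges_pathRegion, Finset.mem_image,
      Finset.mem_insert, Finset.mem_singleton]
    constructor
    · rintro ⟨⟨p, -, p', hp', rfl, hpp'⟩, hL⟩
      obtain rfl : p = v :=
        downTriangle_injective (hL.resolve_left (downTriangle_ne_upTriangle v p').symm)
      exact ⟨p', ⟨by grind, hp'⟩, rfl⟩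
    · rintro ⟨p', ⟨hp', hp'U⟩, rfl⟩
      exact ⟨⟨v, hD, p', hp'U, rfl, Or.inr hp'⟩, Or.inr rfl⟩
  have west_ne_north : west v ≠ north v := by simp [west, north]
  rw [tilingSum_eq_sum_covering w (downTriangle_mem_pathRegion.2 hD), cover,
    Finset.sum_image fun _ _ _ _ h => upTriangle_injective (Prod.ext_iff.1 h).1,
    Finset.sum_filter, Finset.sum_pair west_ne_north]
  simp only [pathRegion_sdiff_pair]

end PathRegions

section NonintersectingPaths

variable {n : ℕ} {K : Type*} [CommRing K] {w : UnitTriangle × UnitTriangle → K}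
  {V : Finset (ℤ × ℤ)} {s t : Fin n → ℤ × ℤ} {G : ℤ × ℤ → Fin n → K} {v v' : ℤ × ℤ} {i : Fin n}

/-- `G p k` is the generating function of the lattice paths from `p` to the sink `t k` with all
vertices before the sink in `V`.  A step from `p` to `p'` carries the weight of the lozenge formed
by `downTriangle p` and `upTriangle p'`. -/
structure IsPathGF (w : UnitTriangle × UnitTriangle → K) (V : Finset (ℤ × ℤ))
    (t : Fin n → ℤ × ℤ) (G : ℤ × ℤ → Fin n → K) : Prop where
  sink : ∀ k, G (t k) = Pi.single k 1
  step : ∀ p ∈ V, G p =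
    (if west p ∈ V ∪ Finset.univ.image t then
      w (upTriangle (west p), downTriangle p) • G (west p) else 0) +
    (if north p ∈ V ∪ Finset.univ.image t then
      w (upTriangle (north p), downTriangle p) • G (north p) else 0)

/-- Admissible starting points of non-intersecting paths in `V` with sinks `t`: they are listed by
increasing height and, at equal height, from left to right, and no vertex of `V` lies in the row
just below a starting point and to the right of it.  The last condition prevents a path from a
lower starting point from passing to the right of a higher one. -/
structure IsSourceConfig (V : Finset (ℤ × ℤ)) (t s : Fin n → ℤ × ℤ) : Prop where
  mem : ∀ i, s i ∈ V ∪ Finset.univ.image t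
  strictMono : StrictMono fun i => toLex (s i).swap
  fst_le : ∀ i, ∀ p ∈ V, p.2 + 1 = (s i).2 → p.1 ≤ (s i).1

theorem toLex_swap_lt {p p' : ℤ × ℤ} :
    toLex p.swap < toLex p'.swap ↔ p.2 < p'.2 ∨ p.2 = p'.2 ∧ p.1 < p'.1 := by
  simp [Prod.Lex.toLex_lt_toLex]

theorem IsSourceConfig.injective (hs : IsSourceConfig V t s) : Function.Injective s :=
  fun _ _ h => hs.strictMono.injective (congrArg (fun p => toLex p.swap) h)

theorem IsPathGF.of_insert (hG : IsPathGF w (insert v V) t G)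
    (hv : ∀ p ∈ V, v.2 < p.2 ∨ v.2 = p.2 ∧ p.1 < v.1) : IsPathGF w V t G where
  sink := hG.sink
  step p hp := by
    have west_ne : west p ≠ v := by rintro rfl; grind [west]
    have north_ne : north p ≠ v := by rintro rfl; grind [north]
    simpa only [Finset.insert_union, Finset.mem_insert, west_ne, north_ne, false_or] using
      hG.step p (Finset.mem_insert_of_mem hp)

theorem IsSourceConfig.of_insert (hs : IsSourceConfig (insert v V) t s) (hvs : ∀ i, s i ≠ v) :
    IsSourceConfig V t s where
  mem i := Finset.mem_of_mem_insert_of_ne (Finset.insert_union v V _ ▸ hs.mem i) (hvs i)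
  strictMono := hs.strictMono
  fst_le i p hp := hs.fst_le i p (Finset.mem_insert_of_mem hp)

theorem IsSourceConfig.update_west (hs : IsSourceConfig (insert (s i) V) t s)
    (hv : ∀ p ∈ V, (s i).2 < p.2 ∨ (s i).2 = p.2 ∧ p.1 < (s i).1)
    (hmem : west (s i) ∈ V ∪ Finset.univ.image t) (hfree : ∀ j, s j ≠ west (s i)) :
    IsSourceConfig V t (Function.update s i (west (s i))) where
  mem j := by
    rcases eq_or_ne j i with rfl | hj
    · simpa using hmem
    · have := hs.mem j
      have := hs.injective.ne hj
      grind
  strictMono j k hjk := by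
    have hlt := toLex_swap_lt.1 (hs.strictMono hjk)
    rw [toLex_swap_lt]
    rcases eq_or_ne j i with rfl | hj
    · rw [Function.update_self, Function.update_of_ne hjk.ne']
      grind [west]
    rcases eq_or_ne k i with rfl | hk
    · rw [Function.update_self, Function.update_of_ne hjk.ne]
      have := hfree j
      grind [west]
    · rwa [Function.update_of_ne hj, Function.update_of_ne hk]
  fst_le j p hp := by
    rcases eq_or_ne j i with rfl | hj
    · rw [Function.update_self]
      grind [west]
    · rw [Function.update_of_ne hj]
      exact hs.fst_le j p (Finset.mem_insert_of_mem hp)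

theorem IsSourceConfig.update_north (hs : IsSourceConfig (insert (s i) V) t s)
    (hv : ∀ p ∈ V, (s i).2 < p.2 ∨ (s i).2 = p.2 ∧ p.1 < (s i).1)
    (ht : ∀ k, (t k).2 = (s i).2 → (t k).1 < (s i).1)
    (hmem : north (s i) ∈ V ∪ Finset.univ.image t) (hfree : ∀ j, s j ≠ north (s i)) :
    IsSourceConfig V t (Function.update s i (north (s i))) where
  mem j := by
    rcases eq_or_ne j i with rfl | hj
    · simpa using hmem
    · have := hs.mem j
      have := hs.injective.ne hj
      grind
  strictMono j k hjk := by
    have hlt := toLex_swap_lt.1 (hs.strictMono hjk)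
    rw [toLex_swap_lt]
    rcases eq_or_ne j i with rfl | hj
    · rw [Function.update_self, Function.update_of_ne hjk.ne']
      have := hfree k
      have := hs.mem k
      have := hs.fst_le k (s j) (Finset.mem_insert_self _ _)
      grind [north]
    rcases eq_or_ne k i with rfl | hk
    · rw [Function.update_self, Function.update_of_ne hjk.ne]
      grind [north]
    · rwa [Function.update_of_ne hj, Function.update_of_ne hk]
  fst_le j p hp := by
    rcases eq_or_ne j i with rfl | hj
    · rw [Function.update_self]
      grind [north]
    · rw [Function.update_of_ne hj]
      exact hs.fst_le j p (Finset.mem_insert_of_mem hp)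

theorem ite_mul_eq_det_updateRow {X : Finset (ℤ × ℤ)} {c y : K} (hv' : v' ≠ s i)
    (hy : v' ∈ X → (∀ j, s j ≠ v') →
      y = (Matrix.of fun k => G (Function.update s i v' k)).det) :
    (if v' ∈ X \ Finset.univ.image s then c * y else 0) =
      ((Matrix.of fun k => G (s k)).updateRow i (if v' ∈ X then c • G v' else 0)).det := by
  by_cases hX : v' ∈ X
  · rw [if_pos hX, Matrix.det_updateRow_smul]
    by_cases hs : ∃ j, s j = v'
    · obtain ⟨j, rfl⟩ := hs
      have hji : j ≠ i := fun h => hv' (congrArg s h)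
      rw [if_neg (by simp), Matrix.det_zero_of_row_eq hji, mul_zero]
      rw [Matrix.updateRow_self, Matrix.updateRow_ne hji]
      rfl
    · simp only [not_exists] at hs
      rw [if_pos (by simpa [hX] using hs), hy hX hs]
      congr 2
      ext k l
      by_cases hk : k = i <;> simp [Matrix.updateRow_apply, Function.update_apply, hk]
  · rw [if_neg (by simp [hX]), if_neg hX, Matrix.det_eq_zero_of_row_eq_zero i (by simp)]

theorem erase_sdiff_image_update {X : Finset (ℤ × ℤ)} (hi : s i ∉ X) :
    (insert (s i) X \ Finset.univ.image s).erase v' =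
      X \ Finset.univ.image (Function.update s i v') := by
  ext p
  simp only [Finset.mem_erase, Finset.mem_sdiff, Finset.mem_insert, Finset.mem_image,
    Finset.mem_univ, true_and, not_exists]
  constructor
  · rintro ⟨hpv', hpX, hps⟩
    refine ⟨hpX.resolve_left fun h => hps i h.symm, fun j => ?_⟩
    rcases eq_or_ne j i with rfl | hj
    · simpa using hpv'.symm
    · simpa [hj] using hps j
  · rintro ⟨hpX, hps⟩
    refine ⟨fun h => hps i (by simp [h]), Or.inr hpX, fun j => ?_⟩
    rcases eq_or_ne j i with rfl | hj
    · exact fun h => hi (h ▸ hpX)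
    · simpa [hj] using hps j

theorem IsSourceConfig.eq_of_empty (ht : StrictMono fun k => toLex (t k).swap)
    (hs : IsSourceConfig ∅ t s) : s = t := by
  have hmem : ∀ i, ∃ k, t k = s i := fun i => by simpa using hs.mem i
  choose σ hσ using hmem
  have σ_strictMono : StrictMono σ := fun i j hij => by
    rw [← ht.lt_iff_lt, hσ, hσ]
    exact hs.strictMono hij
  have σ_eq_id : σ = id := (σ_strictMono.range_inj strictMono_id).1 <| by
    rw [(Finite.injective_iff_surjective.1 σ_strictMono.injective).range_eq, Set.range_id]
  exact funext fun i => by rw [← hσ, σ_eq_id, id]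

theorem tilingSum_pathRegion_of_isolated_eq (hvV : v ∉ V) (hvt : v ∉ V ∪ Finset.univ.image t)
    (hv : ∀ p ∈ V, v.2 < p.2 ∨ v.2 = p.2 ∧ p.1 < v.1) (hvs : ∀ i, s i ≠ v)
    (hw : w (upTriangle v, downTriangle v) = 1) :
    tilingSum w (pathRegion (insert v V)
        ((insert v V ∪ Finset.univ.image t) \ Finset.univ.image s)) =
      tilingSum w (pathRegion V ((V ∪ Finset.univ.image t) \ Finset.univ.image s)) := by
  have isolated : ∀ p ∈ insert v V, west p ≠ v ∧ north p ≠ v := fun p hp => by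
    constructor <;> rintro rfl <;> grind [west, north]
  rw [tilingSum_pathRegion_of_isolated w (Finset.mem_insert_self _ _) (by simpa using hvs)
    isolated, hw, one_mul, Finset.erase_insert hvV, Finset.insert_union,
    ← Finset.erase_sdiff_comm, Finset.erase_insert hvt]

theorem tilingSum_pathRegion_of_source_eq_det (hG : IsPathGF w (insert (s i) V) t G)
    (hvV : s i ∉ V) (hvt : s i ∉ V ∪ Finset.univ.image t)
    (ih : ∀ v', v' = west (s i) ∨ v' = north (s i) → v' ∈ V ∪ Finset.univ.image t →
      (∀ j, s j ≠ v') → tilingSum w (pathRegion V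
          ((V ∪ Finset.univ.image t) \ Finset.univ.image (Function.update s i v'))) =
        (Matrix.of fun k => G (Function.update s i v' k)).det) :
    tilingSum w (pathRegion (insert (s i) V)
        ((insert (s i) V ∪ Finset.univ.image t) \ Finset.univ.image s)) =
      (Matrix.of fun k => G (s k)).det := by
  have west_ne : west (s i) ≠ s i := by simp [west, Prod.ext_iff]
  have north_ne : north (s i) ≠ s i := by simp [north, Prod.ext_iff]
  have row : (Matrix.of fun k => G (s k)) =
      (Matrix.of fun k => G (s k)).updateRow i (G (s i)) := (Matrix.updateRow_eq_self _ i).symm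
  rw [tilingSum_pathRegion_of_source w (Finset.mem_insert_self _ _) (by simp), row,
    hG.step _ (Finset.mem_insert_self _ _), Matrix.det_updateRow_add,
    Finset.erase_insert hvV, Finset.insert_union, erase_sdiff_image_update hvt,
    erase_sdiff_image_update hvt]
  congr 1
  · exact ite_mul_eq_det_updateRow west_ne fun hmem =>
      ih _ (Or.inl rfl) (Finset.mem_of_mem_insert_of_ne hmem west_ne)
  · exact ite_mul_eq_det_updateRow north_ne fun hmem =>
      ih _ (Or.inr rfl) (Finset.mem_of_mem_insert_of_ne hmem north_ne)

/-- The Lindström–Gessel–Viennot lemma, by a sweep of the vertices row by row, from right to left: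
either no path passes through the first vertex, or it is a starting point, and then expanding the
tilings along its triangle corresponds to expanding the determinant along its row. -/
theorem tilingSum_pathRegion_eq_det (hw : ∀ p ∈ V, w (upTriangle p, downTriangle p) = 1)
    (ht : StrictMono fun k => toLex (t k).swap)
    (htV : ∀ k, ∀ p ∈ V, (t k).2 = p.2 → (t k).1 < p.1)
    (hG : IsPathGF w V t G) (hs : IsSourceConfig V t s) :
    tilingSum w (pathRegion V ((V ∪ Finset.univ.image t) \ Finset.univ.image s)) =
      (Matrix.of fun i => G (s i)).det := by
  induction V using Finset.induction_on_min_value (fun p : ℤ × ℤ => toLex (p.2, -p.1))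
    generalizing s with
  | empty =>
    obtain rfl := hs.eq_of_empty ht
    have : (Matrix.of fun i => G (s i)) = 1 := by
      ext i j
      simp [hG.sink, Matrix.one_apply, Pi.single_apply, eq_comm]
    simp [this, pathRegion, tilingSum_empty]
  | insert v V hvV hmin ih =>
    have hv : ∀ p ∈ V, v.2 < p.2 ∨ v.2 = p.2 ∧ p.1 < v.1 := fun p hp => by
      have := hmin p hp
      have : p ≠ v := ne_of_mem_of_not_mem hp hvV
      grind [Prod.Lex.toLex_le_toLex]
    have hvt : v ∉ V ∪ Finset.univ.image t := by
      simp only [Finset.mem_union, hvV, Finset.mem_image, Finset.mem_univ, true_and, false_or]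
      rintro ⟨k, rfl⟩
      exact (htV k _ (Finset.mem_insert_self _ _) rfl).false
    have ih := fun {s} => ih (s := s) (fun p hp => hw p (Finset.mem_insert_of_mem hp))
      (fun k p hp => htV k p (Finset.mem_insert_of_mem hp)) (hG.of_insert hv)
    by_cases hvs : ∃ i, s i = v
    · obtain ⟨i, rfl⟩ := hvs
      refine tilingSum_pathRegion_of_source_eq_det hG hvV hvt ?_
      rintro _ (rfl | rfl) hmem hfree
      · exact ih (hs.update_west hv hmem hfree)
      · exact ih (hs.update_north hv (fun k => htV k _ (Finset.mem_insert_self _ _)) hmem hfree)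
    · rw [not_exists] at hvs
      rw [tilingSum_pathRegion_of_isolated_eq hvV hvt hv hvs (hw v (Finset.mem_insert_self _ _))]
      exact ih (hs.of_insert hvs)

end NonintersectingPaths

section BalancedIntegers

variable {K : Type*} [Field K] {q : K}

/-- The balanced `q`-integer `q ^ (k - 1) + q ^ (k - 3) + ⋯ + q ^ (1 - k)`, continued to an odd
function of `k : ℤ`: a rescaled Chebyshev polynomial of the second kind at `q + q⁻¹`.  Unlike
`(q ^ k - q ^ (-k)) / (q - q⁻¹)`, this makes sense for `q ^ 2 = 1`. -/
noncomputable def balInt (q : K) (k : ℤ) : K :=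
  (Polynomial.Chebyshev.S K (k - 1)).eval (q + q⁻¹)

theorem eq_of_two_term_recurrence {R : Type*} [CommRing R] {s : R} {f g : ℤ → R}
    (hf : ∀ k, f (k + 1) = s * f k - f (k - 1)) (hg : ∀ k, g (k + 1) = s * g k - g (k - 1))
    (h_zero : f 0 = g 0) (h_one : f 1 = g 1) (k : ℤ) : f k = g k := by
  suffices f k = g k ∧ f (k + 1) = g (k + 1) from this.1
  induction k using Int.induction_on with
  | zero => exact ⟨h_zero, by simpa using h_one⟩
  | succ k ih =>
    refine ⟨ih.2, ?_⟩
    rw [hf, hg, ih.2, add_sub_cancel_right, ih.1]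
  | pred k ih =>
    rw [sub_add_cancel]
    refine ⟨?_, ih.1⟩
    have := hf (-k)
    have := hg (-k)
    grind

theorem balInt_rec (q : K) (k : ℤ) :
    balInt q (k + 1) = (q + q⁻¹) * balInt q k - balInt q (k - 1) := by
  have := Polynomial.Chebyshev.S_add_two K (k - 2)
  rw [show k - 2 + 2 = k + 1 - 1 by ring, show k - 2 + 1 = k - 1 by ring,
    show k - 2 = k - 1 - 1 by ring] at this
  rw [balInt, this, Polynomial.eval_sub, Polynomial.eval_mul, Polynomial.eval_X, balInt, balInt]

@[simp]
theorem balInt_zero : balInt q 0 = 0 := by simp [balInt]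

@[simp]
theorem balInt_one : balInt q 1 = 1 := by simp [balInt]

theorem balInt_neg (k : ℤ) : balInt q (-k) = -balInt q k := by
  rw [balInt, balInt, Polynomial.Chebyshev.S_neg_sub_one, Polynomial.eval_neg]

theorem balInt_mul_sub_mul (a b : ℤ) :
    balInt q a * balInt q (b - 1) - balInt q (a - 1) * balInt q b = balInt q (b - a) := by
  refine eq_of_two_term_recurrence (s := q + q⁻¹) (g := fun a => balInt q (b - a))
    (f := fun a => balInt q a * balInt q (b - 1) - balInt q (a - 1) * balInt q b)
    (fun k => ?_) (fun k => ?_) ?_ ?_ a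
  · have := balInt_rec q k
    have := balInt_rec q (k - 1)
    grind
  · have := balInt_rec q (b - k)
    grind
  · simp [balInt_neg]
  · simp

theorem balInt_add_one (hq : q ≠ 0) (c : ℤ) :
    balInt q (c + 1) = balInt q (c - 1) + (q ^ c + q ^ (-c)) := by
  refine eq_of_two_term_recurrence (s := q + q⁻¹) (f := fun c => balInt q (c + 1))
    (g := fun c => balInt q (c - 1) + (q ^ c + q ^ (-c))) (fun k => ?_) (fun k => ?_) ?_ ?_ c
  · have := balInt_rec q (k + 1)
    grind
  · have := balInt_rec q (k - 1)
    simp only [neg_add, neg_sub, zpow_add₀ hq, zpow_sub₀ hq, zpow_one, zpow_neg]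
    grind
  · norm_num [balInt_neg 1]
  · have := balInt_rec q 1
    simp_all

theorem balInt_four_term (hq : q ≠ 0) (c b : ℤ) :
    balInt q (c + 1) * balInt q (c - 1 + b) = balInt q (c - 1) * balInt q (c + 1 - b) +
      (q ^ c + q ^ (-c)) * (balInt q c * balInt q b) := by
  refine eq_of_two_term_recurrence (s := q + q⁻¹)
    (f := fun b => balInt q (c + 1) * balInt q (c - 1 + b))
    (g := fun b => balInt q (c - 1) * balInt q (c + 1 - b) +
      (q ^ c + q ^ (-c)) * (balInt q c * balInt q b)) (fun k => ?_) (fun k => ?_) ?_ ?_ b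
  · have := balInt_rec q (c - 1 + k)
    grind
  · have := balInt_rec q (c + 1 - k)
    have := balInt_rec q k
    grind
  · simp [mul_comm]
  · simp [balInt_add_one hq c, add_mul]

theorem balInt_add_one_eq_inv_mul_add (hq : q ≠ 0) (k : ℤ) :
    balInt q (k + 1) = q⁻¹ * balInt q k + q ^ k := by
  refine eq_of_two_term_recurrence (s := q + q⁻¹) (f := fun k => balInt q (k + 1))
    (g := fun k => q⁻¹ * balInt q k + q ^ k) (fun k => ?_) (fun k => ?_) ?_ ?_ k
  · have := balInt_rec q (k + 1)
    grind
  · have := balInt_rec q k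
    simp only [zpow_add₀ hq, zpow_sub₀ hq, zpow_one]
    grind
  · simp
  · have := balInt_rec q 1
    simp_all [add_comm]

theorem qInt_sq_eq (hq : q ≠ 0) (k : ℕ) : qInt (q ^ 2) k = q ^ ((k : ℤ) - 1) * balInt q k := by
  induction k with
  | zero => simp [qInt]
  | succ k ih =>
    have qInt_succ : qInt (q ^ 2) (k + 1 : ℕ) = qInt (q ^ 2) k + (q ^ 2) ^ k := by
      simp [qInt, Int.toNat_natCast_add_one, Finset.sum_range_succ]
    rw [qInt_succ, ih, Nat.cast_succ, balInt_add_one_eq_inv_mul_add hq, add_sub_cancel_right,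
      zpow_sub_one₀ hq, zpow_natCast, ← pow_mul]
    ring

theorem balInt_ne_zero (hq : q ≠ 0) (hq_int : ∀ k : ℕ, 1 ≤ k → qInt (q ^ 2) k ≠ 0) {k : ℤ}
    (hk : 1 ≤ k) : balInt q k ≠ 0 := by
  lift k to ℕ using by lia
  have := hq_int k (by exact_mod_cast hk)
  rw [qInt_sq_eq hq] at this
  exact right_ne_zero_of_mul this

end BalancedIntegers

section PathGF

variable {K : Type*} [Field K] {q : K}

/-- The factorial that belongs to `balInt`. -/
noncomputable def balFact (q : K) (m : ℕ) : K := ∏ k ∈ Finset.range m, balInt q (k + 1)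

/-- The generating function of the lattice paths from abscissa `c` to the west side with `B`
vertical lozenges, continued to all integers `c`.  The continuation satisfies the recursion of the
path generating functions with weight `(q ^ c + q ^ (-c)) / 2` for all `c`, also for `c = 0`. -/
noncomputable def pathGF (q : K) (c : ℤ) : ℤ → K
  | Int.negSucc _ => 0
  | Int.ofNat 0 => 1
  | Int.ofNat (b + 1) => ((2 : K) ^ (b + 1))⁻¹ * balInt q (c + 1) *
      (∏ k ∈ Finset.range b, balInt q (c - b + 2 * (k + 1))) / balFact q (b + 1)

theorem balFact_succ (m : ℕ) : balFact q (m + 1) = balFact q m * balInt q (m + 1) :=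
  Finset.prod_range_succ _ _

theorem balFact_ne_zero (hq : q ≠ 0) (hq_int : ∀ k : ℕ, 1 ≤ k → qInt (q ^ 2) k ≠ 0) (m : ℕ) :
    balFact q m ≠ 0 :=
  Finset.prod_ne_zero_iff.2 fun _ _ => balInt_ne_zero hq hq_int (by lia)

theorem pathGF_of_neg (c : ℤ) {B : ℤ} (hB : B < 0) : pathGF q c B = 0 := by
  obtain ⟨b, rfl⟩ := Int.eq_negSucc_of_lt_zero hB
  rfl

@[simp]
theorem pathGF_zero (c : ℤ) : pathGF q c 0 = 1 := rfl

theorem pathGF_succ (c : ℤ) (b : ℕ) :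
    pathGF q c (b + 1) = ((2 : K) ^ (b + 1))⁻¹ * balInt q (c + 1) *
      (∏ k ∈ Finset.range b, balInt q (c - b + 2 * (k + 1))) / balFact q (b + 1) := rfl

theorem pathGF_neg_one (B : ℤ) : pathGF q (-1) B = if B = 0 then 1 else 0 := by
  rcases lt_trichotomy B 0 with hB | rfl | hB
  · rw [pathGF_of_neg _ hB, if_neg hB.ne]
  · simp
  · obtain ⟨b, rfl⟩ := Int.eq_succ_of_zero_lt hB
    rw [if_neg hB.ne', pathGF_succ]
    simp

theorem pathGF_rec_succ_succ (h_two : (2 : K) ≠ 0) (hq : q ≠ 0)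
    (hq_int : ∀ k : ℕ, 1 ≤ k → qInt (q ^ 2) k ≠ 0) (c : ℤ) (b : ℕ) :
    pathGF q c ((b + 1 : ℕ) + 1) = pathGF q (c - 2) ((b + 1 : ℕ) + 1) +
      (q ^ c + q ^ (-c)) / 2 * pathGF q (c - 1) (b + 1) := by
  have fact_ne := balFact_ne_zero hq hq_int (b + 1)
  have last_ne : balInt q ((b : ℤ) + 2) ≠ 0 := balInt_ne_zero hq hq_int (by lia)
  set P := ∏ k ∈ Finset.range b, balInt q (c + 1 - b + 2 * k) with hP
  have prod_c : ∏ k ∈ Finset.range (b + 1), balInt q (c - (b + 1 : ℕ) + 2 * (k + 1)) =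
      P * balInt q (c - 1 + (b + 2)) := by
    rw [Finset.prod_range_succ, hP]
    push_cast
    ring_nf
  have prod_c_sub_one : ∏ k ∈ Finset.range b, balInt q (c - 1 - b + 2 * (k + 1)) = P :=
    Finset.prod_congr rfl fun k _ => by ring_nf
  have prod_c_sub_two :
      ∏ k ∈ Finset.range (b + 1), balInt q (c - 2 - (b + 1 : ℕ) + 2 * (k + 1)) =
        P * balInt q (c + 1 - (b + 2)) := by
    rw [Finset.prod_range_succ', hP]
    push_cast
    ring_nf
  have fact_succ : balFact q (b + 1 + 1) = balFact q (b + 1) * balInt q (b + 2) := by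
    rw [balFact_succ]
    push_cast
    ring_nf
  have four_term := balInt_four_term hq c (b + 2)
  rw [pathGF_succ, pathGF_succ, pathGF_succ, prod_c, prod_c_sub_one, prod_c_sub_two, fact_succ,
    sub_add_cancel, show c - 2 + 1 = c - 1 by ring, pow_succ]
  field_simp
  linear_combination P * four_term

theorem pathGF_rec (h_two : (2 : K) ≠ 0) (hq : q ≠ 0)
    (hq_int : ∀ k : ℕ, 1 ≤ k → qInt (q ^ 2) k ≠ 0) (c B : ℤ) :
    pathGF q c B = pathGF q (c - 2) B + (q ^ c + q ^ (-c)) / 2 * pathGF q (c - 1) (B - 1) := by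
  rcases lt_or_ge B 0 with hB | hB
  · simp [pathGF_of_neg _ hB, pathGF_of_neg _ (show B - 1 < 0 by lia)]
  lift B to ℕ using hB
  rcases B with _ | _ | b
  · simp [pathGF_of_neg]
  · have h_one := pathGF_succ (q := q) (b := 0)
    simp only [Nat.cast_zero, zero_add, pow_one, Finset.range_zero, Finset.prod_empty, mul_one,
      balFact, Finset.prod_range_one, balInt_one, div_one] at h_one
    rw [Nat.cast_succ, Nat.cast_zero, zero_add, h_one, h_one, sub_self, pathGF_zero,
      balInt_add_one hq, show c - 2 + 1 = c - 1 by ring]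
    ring
  · simpa using pathGF_rec_succ_succ h_two hq hq_int c b

theorem pathGF_reflect (c : ℤ) (b : ℕ) : pathGF q (-c - 2) b = (-1) ^ b * pathGF q c b := by
  rcases b with _ | b
  · simp
  rw [Nat.cast_succ, pathGF_succ, pathGF_succ, show -c - 2 + 1 = -(c + 1) by ring, balInt_neg]
  have prod_reflect : ∏ k ∈ Finset.range b, balInt q (-c - 2 - b + 2 * (k + 1)) =
      (-1) ^ b * ∏ k ∈ Finset.range b, balInt q (c - b + 2 * (k + 1)) := by
    rw [← Finset.prod_range_reflect, Finset.pow_eq_prod_const, ← Finset.prod_mul_distrib]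
    refine Finset.prod_congr rfl fun k hk => ?_
    rw [neg_one_mul, ← balInt_neg]
    congr 1
    have := Finset.mem_range.1 hk
    lia
  rw [prod_reflect]
  ring

/-- On the axis the step to the west leads to the mirror image of the starting point, so that the
weight of the vertical step is effectively halved. -/
theorem pathGF_zero_left (h_two : (2 : K) ≠ 0) (hq : q ≠ 0)
    (hq_int : ∀ k : ℕ, 1 ≤ k → qInt (q ^ 2) k ≠ 0) {B : ℤ} (hB : Odd B) :
    pathGF q 0 B = 1 / 2 * pathGF q (-1) (B - 1) := by
  have rec_zero := pathGF_rec h_two hq hq_int 0 B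
  rcases lt_or_ge B 0 with hB' | hB'
  · rw [pathGF_of_neg _ hB', pathGF_of_neg _ (by lia), mul_zero]
  lift B to ℕ using hB'
  have reflect := pathGF_reflect (q := q) 0 B
  rw [Odd.neg_one_pow (by exact_mod_cast hB), neg_zero, zero_sub] at reflect
  rw [neg_zero, zero_sub, zero_sub, reflect, zpow_zero, one_add_one_eq_two, div_self h_two]
    at rec_zero
  field_simp
  linear_combination rec_zero

/-- The product `⟨2⟩⟨4⟩⋯⟨2m⟩` of balanced `q`-integers. -/
noncomputable def evenFact (q : K) (m : ℕ) : K := ∏ k ∈ Finset.range m, balInt q (2 * (k + 1))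

theorem evenFact_ne_zero (hq : q ≠ 0) (hq_int : ∀ k : ℕ, 1 ≤ k → qInt (q ^ 2) k ≠ 0) (m : ℕ) :
    evenFact q m ≠ 0 :=
  Finset.prod_ne_zero_iff.2 fun _ _ => balInt_ne_zero hq hq_int (by lia)

theorem evenFact_succ (m : ℕ) : evenFact q (m + 1) = evenFact q m * balInt q (2 * (m + 1)) :=
  Finset.prod_range_succ _ _

theorem evenFact_add (m l : ℕ) :
    evenFact q (m + l) = evenFact q m * ∏ k ∈ Finset.range l, balInt q (2 * (m + k + 1)) := by
  rw [evenFact, Finset.prod_range_add, ← evenFact]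
  push_cast
  rfl

theorem balFact_add (m j : ℕ) :
    balFact q (m + j) = balFact q m * ∏ r ∈ Finset.range j, balInt q (m + j - r) := by
  rw [balFact, Finset.prod_range_add, ← balFact, ← Finset.prod_range_reflect]
  congr 1
  refine Finset.prod_congr rfl fun r hr => ?_
  rw [Finset.mem_range] at hr
  congr 1
  lia

theorem pathGF_eq_evenFact_div (h_two : (2 : K) ≠ 0) (hq : q ≠ 0)
    (hq_int : ∀ k : ℕ, 1 ≤ k → qInt (q ^ 2) k ≠ 0) {A b : ℕ} (hAb : 1 ≤ A + b) :
    pathGF q (2 * A + b - 1) b =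
      balInt q (2 * A + b) * evenFact q (A + b - 1) / (2 ^ b * evenFact q A * balFact q b) := by
  have even_ne := evenFact_ne_zero hq hq_int A
  have fact_ne := balFact_ne_zero hq hq_int b
  rw [eq_div_iff (by positivity)]
  rcases b with _ | b
  · obtain ⟨A, rfl⟩ : ∃ M, A = M + 1 := ⟨A - 1, by lia⟩
    simp [balFact, evenFact_succ, mul_comm]
  · have prod_even : ∏ k ∈ Finset.range b, balInt q (2 * A + (b + 1) - 1 - b + 2 * (k + 1)) =
        ∏ k ∈ Finset.range b, balInt q (2 * (A + k + 1)) :=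
      Finset.prod_congr rfl fun k _ => by ring_nf
    rw [Nat.add_succ_sub_one, evenFact_add, Nat.cast_succ, pathGF_succ, prod_even, sub_add_cancel]
    field_simp

theorem pathGF_eq_zero {c B : ℤ} (hc : -1 ≤ c) (hcB : c + 1 < B) (hodd : Odd (c + B)) :
    pathGF q c B = 0 := by
  obtain ⟨r, hr⟩ := hodd
  obtain ⟨b, rfl⟩ : ∃ b : ℕ, B = b + 1 := ⟨(B - 1).toNat, by lia⟩
  have zero_factor : balInt q (c - b + 2 * (((r - c - 1).toNat : ℕ) + 1)) = 0 := by
    rw [← balInt_zero (q := q)]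
    congr 1
    lia
  rw [pathGF_succ, Finset.prod_eq_zero (Finset.mem_range.2 ?_) zero_factor]
  · simp
  · lia

end PathGF

section TypeCRegion

variable {u N n : ℕ} {h : Fin n → ℕ}

/-- The vertices `p` of the path lattice whose down-pointing triangle lies in the halved hexagon;
`N` is the length of the south side. -/
noncomputable def halvedHexagonVertices (u N n : ℕ) : Finset (ℤ × ℤ) :=
  (Finset.Icc (0 : ℤ) (N + n) ×ˢ Finset.Ico (0 : ℤ) (2 * u)).filter fun p =>
    p.2 ≤ 2 * p.1 ∧ p.1 ≤ N + p.2 ∧ p.1 < N + n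

/-- The starting points of the lattice paths, at the triangles along the southeast side. -/
def southeastSource (N : ℕ) (i : Fin n) : ℤ × ℤ := (N + i, i)

/-- The endpoints of the lattice paths, at the triangles that remain in the bumps of the west
side. -/
def bumpSink (h : Fin n → ℕ) (k : Fin n) : ℤ × ℤ := (h k - 1, 2 * h k - 1)

theorem mem_halvedHexagonVertices {p : ℤ × ℤ} :
    p ∈ halvedHexagonVertices u N n ↔
      0 ≤ p.2 ∧ p.2 < 2 * u ∧ p.2 ≤ 2 * p.1 ∧ p.1 ≤ N + p.2 ∧ p.1 < N + n := by
  simp only [halvedHexagonVertices, Finset.mem_filter, Finset.mem_product, Finset.mem_Icc,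
    Finset.mem_Ico]
  lia

theorem mem_image_bumpSink {p : ℤ × ℤ} :
    p ∈ Finset.univ.image (bumpSink h) ↔ ∃ k, p = ((h k : ℤ) - 1, 2 * (h k : ℤ) - 1) := by
  simp [bumpSink, eq_comm]

theorem mem_image_southeastSource {p : ℤ × ℤ} :
    p ∈ Finset.univ.image (southeastSource (n := n) N) ↔ p.1 = N + p.2 ∧ 0 ≤ p.2 ∧ p.2 < n := by
  obtain ⟨a, j⟩ := p
  simp only [southeastSource, Finset.mem_image, Finset.mem_univ, true_and, Prod.mk.injEq]
  constructor
  · rintro ⟨i, rfl, rfl⟩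
    have := i.isLt
    lia
  · rintro ⟨ha, hj, hjn⟩
    exact ⟨⟨j.toNat, by lia⟩, by simp only; lia, by simp only; lia⟩

theorem typeCRegion_eq_pathRegion {x : ℕ} (hN : N + n = x + u)
    (h_mem : ∀ i, 1 ≤ h i ∧ h i ≤ u) :
    typeCRegion x u h = pathRegion (halvedHexagonVertices u N n)
      ((halvedHexagonVertices u N n ∪ Finset.univ.image (bumpSink h)) \
        Finset.univ.image (southeastSource (n := n) N)) := by
  have hN' : (x : ℤ) + u - n = N := by lia
  refine eq_pathRegion_iff.2 ⟨fun p => ?_, fun p => ?_⟩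
  · simp only [typeCRegion, halvedHexagon, downTriangle, mem_halvedHexagonVertices, hN',
      Finset.mem_sdiff, Finset.mem_filter, Finset.mem_product, Finset.mem_Icc, Finset.mem_Ico,
      Finset.mem_image, Prod.mk.injEq]
    grind
  · rw [Finset.mem_sdiff, Finset.mem_union, mem_image_bumpSink, mem_image_southeastSource,
      mem_halvedHexagonVertices]
    simp only [typeCRegion, halvedHexagon, upTriangle, hN', Finset.mem_sdiff, Finset.mem_filter,
      Finset.mem_product, Finset.mem_Icc, Finset.mem_Ico, Finset.mem_image, Prod.ext_iff]
    constructor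
    · rintro ⟨⟨hbox, hse, hne⟩, hbump⟩
      refine ⟨?_, by lia⟩
      by_cases hc : p.2 ≤ 2 * p.1
      · left; lia
      · right
        by_contra! hsink
        refine hbump ⟨(p.1 + 1).toNat, ⟨⟨by lia, by lia⟩, fun i hi => ?_⟩, by lia, by lia⟩
        exact hsink i (by lia) (by lia)
    · rintro ⟨hV | ⟨k, hk⟩, hS⟩
      · refine ⟨⟨⟨⟨by lia, by lia⟩, by lia, by lia⟩, by lia, by lia⟩, ?_⟩
        rintro ⟨l, -, hl, -⟩
        lia
      · have := h_mem k
        refine ⟨⟨⟨⟨by lia, by lia⟩, by lia, by lia⟩, by lia, by lia⟩, ?_⟩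
        rintro ⟨l, ⟨-, hl⟩, -, hl'⟩
        exact hl k (by lia)

variable {K : Type*} [Field K] {q : K}

theorem wtTwo_right (p : ℤ × ℤ) : wtTwo q (upTriangle p, downTriangle p) = 1 := by
  simp [wtTwo, upTriangle, downTriangle]

theorem wtTwo_west (p : ℤ × ℤ) : wtTwo q (upTriangle (west p), downTriangle p) = 1 := by
  refine if_neg ?_
  simp only [upTriangle, downTriangle, west, Prod.mk.injEq]
  lia

theorem wtTwo_north (p : ℤ × ℤ) : wtTwo q (upTriangle (north p), downTriangle p) =
    if 2 * p.1 - p.2 = 0 then 1 / 2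
    else (q ^ (2 * p.1 - p.2) + q ^ (-(2 * p.1 - p.2))) / 2 := by
  have abscissa : 2 * p.1 - (p.2 + 1) + 1 = 2 * p.1 - p.2 := by ring
  simp [wtTwo, upTriangle, downTriangle, north, abscissa]

/-- The generating function of the lattice paths from `p` to the bump `h k`. -/
noncomputable def bumpPathGF (q : K) (h : Fin n → ℕ) (p : ℤ × ℤ) (k : Fin n) : K :=
  pathGF q (2 * p.1 - p.2) (2 * h k - 1 - p.2)

theorem bumpPathGF_bumpSink (h_inj : Function.Injective h) (k : Fin n) :
    bumpPathGF q h (bumpSink h k) = Pi.single k 1 := by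
  ext l
  have abscissa : 2 * ((h k : ℤ) - 1) - (2 * h k - 1) = -1 := by ring
  rw [bumpPathGF, bumpSink, abscissa, pathGF_neg_one, Pi.single_apply]
  refine if_congr ?_ rfl rfl
  rw [← h_inj.eq_iff]
  lia

theorem bumpPathGF_eq_zero (h_mem : ∀ i, 1 ≤ h i ∧ h i ≤ u) {p : ℤ × ℤ}
    (hp : p.2 ≤ 2 * p.1 + 1) (hp' : 0 ≤ p.2) (hpN : p.1 ≤ N + p.2) (hpn : p.1 < N + n)
    (hpV : p ∉ halvedHexagonVertices u N n ∪ Finset.univ.image (bumpSink h)) :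
    bumpPathGF q h p = 0 := by
  simp only [Finset.mem_union, mem_halvedHexagonVertices, mem_image_bumpSink, Prod.ext_iff,
    not_or, not_exists] at hpV
  ext k
  have := h_mem k
  have := hpV.2 k
  rcases hp.eq_or_lt with hp | hp
  · rw [bumpPathGF, show 2 * p.1 - p.2 = -1 by lia, pathGF_neg_one, if_neg (by lia)]
    rfl
  · exact pathGF_of_neg _ (by lia)

theorem isPathGF_bumpPathGF (h_two : (2 : K) ≠ 0) (hq : q ≠ 0)
    (hq_int : ∀ k : ℕ, 1 ≤ k → qInt (q ^ 2) k ≠ 0) (h_inj : Function.Injective h)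
    (h_mem : ∀ i, 1 ≤ h i ∧ h i ≤ u) :
    IsPathGF (wtTwo q) (halvedHexagonVertices u N n) (bumpSink h) (bumpPathGF q h) where
  sink := bumpPathGF_bumpSink h_inj
  step p hp := by
    obtain ⟨hp_nonneg, -, hp_axis, hp_le, hp_lt⟩ := mem_halvedHexagonVertices.1 hp
    have north_eq : (if north p ∈ halvedHexagonVertices u N n ∪ Finset.univ.image (bumpSink h) then
        wtTwo q (upTriangle (north p), downTriangle p) • bumpPathGF q h (north p) else 0) =
        wtTwo q (upTriangle (north p), downTriangle p) • bumpPathGF q h (north p) :=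
      ite_eq_left_iff.2 fun hnV => by
        rw [bumpPathGF_eq_zero h_mem (p := north p) (by simp only [north]; lia)
          (by simp only [north]; lia) (by simp only [north]; lia) hp_lt hnV, smul_zero]
    rw [north_eq, wtTwo_west, wtTwo_north, one_smul]
    rcases hp_axis.eq_or_lt with hp_axis | hp_axis
    · have west_notMem :
          west p ∉ halvedHexagonVertices u N n ∪ Finset.univ.image (bumpSink h) := by
        simp only [Finset.mem_union, mem_halvedHexagonVertices, mem_image_bumpSink, west,
          Prod.ext_iff]
        lia
      rw [if_neg west_notMem, if_pos (by lia), zero_add]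
      ext k
      rw [bumpPathGF, show 2 * p.1 - p.2 = 0 by lia, pathGF_zero_left h_two hq hq_int]
      · simp only [bumpPathGF, north, Pi.smul_apply, smul_eq_mul]
        rw [show 2 * p.1 - (p.2 + 1) = -1 by lia, ← sub_sub]
      · exact ⟨h k - 1 - p.1, by lia⟩
    · rw [ite_eq_left_iff.2 fun hwV => (bumpPathGF_eq_zero h_mem (p := west p)
        (by simp only [west]; lia) hp_nonneg (by simp only [west]; lia)
        (by simp only [west]; lia) hwV).symm, if_neg (by lia)]
      ext k
      rw [bumpPathGF, pathGF_rec h_two hq hq_int]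
      simp only [bumpPathGF, north, west, Pi.add_apply, Pi.smul_apply, smul_eq_mul]
      ring_nf

theorem isSourceConfig_southeastSource (hnu : n ≤ u) :
    IsSourceConfig (halvedHexagonVertices u N n) (bumpSink h) (southeastSource N) where
  mem i := Finset.mem_union_left _ <| by
    have := i.isLt
    simp only [mem_halvedHexagonVertices, southeastSource]
    lia
  strictMono i j hij := toLex_swap_lt.2 (Or.inl (by simpa [southeastSource] using hij))
  fst_le i p hp hpi := by
    rw [mem_halvedHexagonVertices] at hp
    simp only [southeastSource] at hpi ⊢
    lia

theorem tilingGF_typeCRegion_eq_det (h_two : (2 : K) ≠ 0) (hq : q ≠ 0)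
    (hq_int : ∀ k : ℕ, 1 ≤ k → qInt (q ^ 2) k ≠ 0) {x : ℕ} (hnu : n ≤ u) (hN : N + n = x + u)
    (h_mono : StrictMono h) (h_mem : ∀ i, 1 ≤ h i ∧ h i ≤ u) :
    tilingGF q (typeCRegion x u h) =
      (Matrix.of fun i k : Fin n => pathGF q (2 * N + i) (2 * h k - 1 - i)).det := by
  have sinks_mono : StrictMono fun k => toLex (bumpSink h k).swap := fun i j hij =>
    toLex_swap_lt.2 (Or.inl (by have := h_mono hij; simp only [bumpSink]; lia))
  have sink_lt : ∀ k, ∀ p ∈ halvedHexagonVertices u N n,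
      (bumpSink h k).2 = p.2 → (bumpSink h k).1 < p.1 := fun k p hp hkp => by
    rw [mem_halvedHexagonVertices] at hp
    simp only [bumpSink] at hkp ⊢
    lia
  rw [typeCRegion_eq_pathRegion hN h_mem]
  refine (tilingSum_pathRegion_eq_det (fun p _ => wtTwo_right p) sinks_mono sink_lt
    (isPathGF_bumpPathGF h_two hq hq_int h_mono.injective h_mem)
    (isSourceConfig_southeastSource hnu)).trans (congrArg Matrix.det ?_)
  ext i k
  simp only [Matrix.of_apply, bumpPathGF, southeastSource]
  ring_nf

end TypeCRegion

section KrattenthalerDeterminant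

theorem exists_prod_linear_eq_sum {ι R : Type*} [CommRing R] (s : Finset ι)
    (f g : ι → R) : ∃ c : ℕ → R, ∀ x y : R, ∏ k ∈ s, (f k * x + g k * y) =
      ∑ l ∈ Finset.range (s.card + 1), x ^ l * y ^ (s.card - l) * c l := by
  classical
  induction s using Finset.induction_on with
  | empty => exact ⟨1, by simp⟩
  | insert k s hk ih =>
    obtain ⟨c, hc⟩ := ih
    refine ⟨fun l => (if l = 0 then 0 else f k * c (l - 1)) +
      (if l = s.card + 1 then 0 else g k * c l), fun x y => ?_⟩
    simp only [Finset.prod_insert hk, hc, Finset.card_insert_of_notMem hk, mul_add,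
      Finset.sum_add_distrib, add_mul]
    congr 1
    · rw [Finset.sum_range_succ' _ (s.card + 1), Finset.mul_sum]
      simp only [if_pos, if_neg (Nat.succ_ne_zero _), mul_zero, add_zero, Nat.add_sub_add_right,
        Nat.add_sub_cancel]
      exact Finset.sum_congr rfl fun l _ => by ring
    · rw [Finset.sum_range_succ _ (s.card + 1), Finset.mul_sum, if_pos rfl, mul_zero, add_zero]
      refine Finset.sum_congr rfl fun l hl => ?_
      rw [Finset.mem_range] at hl
      rw [if_neg hl.ne, Nat.succ_sub (by lia), pow_succ]
      ring

variable {R : Type*} [CommRing R] {n : ℕ}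

theorem exists_det_prod_linear_eq_mul (f g : Fin n → Fin n → R) :
    ∃ C : R, ∀ x y : Fin n → R,
      (Matrix.of fun i j => ∏ k ∈ Finset.univ.erase j, (f j k * x i + g j k * y i)).det =
        (∏ i, ∏ j ∈ Finset.Ioi i, (x j * y i - x i * y j)) * C := by
  choose c hc using fun j => exists_prod_linear_eq_sum (Finset.univ.erase j) (f j) (g j)
  refine ⟨(Matrix.of fun l j : Fin n => c j l).det, fun x y => ?_⟩
  rw [← Matrix.det_projVandermonde, ← Matrix.det_mul]
  congr 1
  ext i j
  obtain ⟨m, rfl⟩ : ∃ m, n = m + 1 := ⟨n - 1, by have := j.pos; lia⟩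
  simp only [Matrix.of_apply, Matrix.mul_apply, Matrix.projVandermonde_apply, hc, Fin.val_rev,
    Finset.card_erase_of_mem (Finset.mem_univ _), Finset.card_univ, Fintype.card_fin,
    Nat.add_sub_cancel, Nat.add_sub_add_right, Finset.sum_range]

/-- The standard area form on the plane. -/
def areaForm (v w : R × R) : R := v.1 * w.2 - v.2 * w.1

theorem exists_det_prod_areaForm_eq_mul (a b : Fin n → R × R) :
    ∃ C : R, ∀ v : Fin n → R × R,
      (Matrix.of fun i j => (∏ k ∈ Finset.Ioi j, areaForm (v i) (a k)) *
        ∏ r ∈ Finset.Iio j, areaForm (b r) (v i)).det =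
      (∏ i, ∏ j ∈ Finset.Ioi i, areaForm (v i) (v j)) * C := by
  obtain ⟨C, hC⟩ := exists_det_prod_linear_eq_mul
    (fun j k => if j < k then -(a k).1 else (b k).1)
    (fun j k => if j < k then (a k).2 else -(b k).2)
  refine ⟨C, fun v => ?_⟩
  convert hC (fun i => (v i).2) (fun i => (v i).1) using 2
  · ext i j
    have split : Finset.univ.erase j = Finset.Ioi j ∪ Finset.Iio j := by
      ext k
      simp [lt_or_lt_iff_ne, eq_comm]
    have disj : Disjoint (Finset.Ioi j) (Finset.Iio j) := Finset.disjoint_left.2 fun k => by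
      simpa using le_of_lt
    simp only [Matrix.of_apply, split, Finset.prod_union disj, areaForm]
    congr 1
    · refine Finset.prod_congr rfl fun k hk => ?_
      rw [if_pos (Finset.mem_Ioi.1 hk), if_pos (Finset.mem_Ioi.1 hk)]
      ring
    · refine Finset.prod_congr rfl fun k hk => ?_
      rw [if_neg (Finset.mem_Iio.1 hk).not_gt, if_neg (Finset.mem_Iio.1 hk).not_gt]
      ring
  · exact Finset.prod_congr rfl fun i _ => Finset.prod_congr rfl fun j _ => by
      rw [areaForm, mul_comm (v i).1, mul_comm (v i).2]

/-- The homogeneous form of a determinant evaluation of Krattenthaler.  The entries of column `j`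
are the values of a product of `n - 1` linear forms that depends only on `j`, so the determinant is
a multiple of a projective Vandermonde determinant; the factor is found at `v = a`, where the
matrix is triangular. -/
theorem det_prod_areaForm [IsDomain R] (a b v : Fin n → R × R)
    (ha : ∀ i j, i < j → areaForm (a i) (a j) ≠ 0) :
    (Matrix.of fun i j => (∏ k ∈ Finset.Ioi j, areaForm (v i) (a k)) *
        ∏ r ∈ Finset.Iio j, areaForm (b r) (v i)).det =
      (∏ i, ∏ j ∈ Finset.Ioi i, areaForm (v i) (v j)) *
        ∏ k, ∏ r ∈ Finset.Iio k, areaForm (b r) (a k) := by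
  obtain ⟨C, hC⟩ := exists_det_prod_areaForm_eq_mul a b
  have triangular : (Matrix.of fun i j => (∏ k ∈ Finset.Ioi j, areaForm (a i) (a k)) *
      ∏ r ∈ Finset.Iio j, areaForm (b r) (a i)).IsUpperTriangular := fun i j hji =>
    mul_eq_zero_of_left (Finset.prod_eq_zero (Finset.mem_Ioi.2 hji)
      (sub_eq_zero_of_eq (mul_comm _ _))) _
  have vandermonde_ne : ∏ i, ∏ j ∈ Finset.Ioi i, areaForm (a i) (a j) ≠ 0 :=
    Finset.prod_ne_zero_iff.2 fun i _ => Finset.prod_ne_zero_iff.2 fun j hj =>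
      ha i j (Finset.mem_Ioi.1 hj)
  have at_a := Matrix.det_of_isUpperTriangular triangular
  simp only [hC, Matrix.of_apply, Finset.prod_mul_distrib] at at_a
  rw [hC, mul_left_cancel₀ vandermonde_ne at_a]

theorem det_prod_balInt {K : Type*} [Field K] {q : K} (x y X : Fin n → ℤ)
    (hx : ∀ i j, i < j → balInt q (x j - x i) ≠ 0) :
    (Matrix.of fun i j => (∏ k ∈ Finset.Ioi j, balInt q (x k - X i)) *
        ∏ r ∈ Finset.Iio j, balInt q (X i - y r)).det =
      (∏ i, ∏ j ∈ Finset.Ioi i, balInt q (X j - X i)) *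
        ∏ k, ∏ r ∈ Finset.Iio k, balInt q (x k - y r) := by
  have area (a b : ℤ) :
      areaForm (balInt q a, balInt q (a - 1)) (balInt q b, balInt q (b - 1)) = balInt q (b - a) :=
    balInt_mul_sub_mul a b
  simpa only [area] using det_prod_areaForm (fun k => (balInt q (x k), balInt q (x k - 1)))
    (fun r => (balInt q (y r), balInt q (y r - 1))) (fun i => (balInt q (X i), balInt q (X i - 1)))
    fun i j hij => (area _ _).trans_ne (hx i j hij)

end KrattenthalerDeterminant

section Evaluation

variable {K : Type*} [Field K] {q : K} {n N : ℕ} {h : Fin n → ℕ}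

/-- The factor contributed by the bump `h` to the tiling generating function. -/
noncomputable def bumpFactor (q : K) (N n h : ℕ) : K :=
  evenFact q (N + h - 1) / (2 ^ (2 * h - 1) * evenFact q (N + n - h) * balFact q (2 * h - 1))

/-- The product formula for the tiling generating function of a region of type C with south side of
length `N`, in terms of balanced `q`-integers. -/
noncomputable def typeCProduct (q : K) (N : ℕ) (h : Fin n → ℕ) : K :=
  (∏ k : Fin n, 2 ^ (k : ℕ) * bumpFactor q N n (h k)) *
    (∏ i, ∏ j ∈ Finset.Ioi i, balInt q (2 * (h j - h i))) *
    ∏ k ∈ Finset.range n, ∏ l ∈ Finset.range (k + 1), balInt q (2 * N + k + l + 1)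

theorem prod_Ioi_eq_prod_range {M : Type*} [CommMonoid M] (j : Fin n) (f : ℕ → M) :
    ∏ k ∈ Finset.Ioi j, f k = ∏ l ∈ Finset.range (n - (j + 1)), f (j + 1 + l) := by
  have map_val : Finset.Ico ((j : ℕ) + 1) n = (Finset.Ioi j).map Fin.valEmbedding := by
    rw [Fin.map_valEmbedding_Ioi]
    rfl
  rw [← Finset.prod_Ico_eq_prod_range, map_val, Finset.prod_map]
  rfl

theorem prod_Iio_eq_prod_range {M : Type*} [CommMonoid M] (j : Fin n) (f : ℕ → M) :
    ∏ r ∈ Finset.Iio j, f r = ∏ r ∈ Finset.range j, f r := by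
  rw [← Nat.Iio_eq_range, ← Fin.map_valEmbedding_Iio, Finset.prod_map]
  rfl

theorem evenFact_eq_mul_prod_Ioi {A h : ℕ} {j : Fin n} (hA : A + h = N + j + 1) :
    evenFact q (N + n - h) =
      evenFact q A * ∏ k ∈ Finset.Ioi j, balInt q (2 * N + 2 * ((k : ℕ) + 1) - 2 * h) := by
  rw [prod_Ioi_eq_prod_range j fun k => balInt q (2 * N + 2 * ((k : ℤ) + 1) - 2 * h),
    show N + n - h = A + (n - (j + 1)) by lia, evenFact_add]
  congr 1
  exact Finset.prod_congr rfl fun k _ => congrArg _ (by lia)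

theorem balFact_eq_mul_prod_Iio {b h : ℕ} {j : Fin n} (hb : b + j + 1 = 2 * h) :
    balFact q (2 * h - 1) =
      balFact q b * ∏ r ∈ Finset.Iio j, balInt q (2 * h - ((r : ℕ) + 1)) := by
  rw [prod_Iio_eq_prod_range j fun r => balInt q (2 * h - ((r : ℤ) + 1)),
    show 2 * h - 1 = b + j by lia, balFact_add]
  congr 1
  exact Finset.prod_congr rfl fun r _ => congrArg _ (by lia)

theorem pathGF_eq_mul_prod (h_two : (2 : K) ≠ 0) (hq : q ≠ 0)
    (hq_int : ∀ k : ℕ, 1 ≤ k → qInt (q ^ 2) k ≠ 0) {h : ℕ} (j : Fin n) (h_pos : 1 ≤ h)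
    (hN : h ≤ N + n) :
    pathGF q (2 * N + j) (2 * h - 1 - j) =
      2 ^ (j : ℕ) * balInt q (2 * N + j + 1) * bumpFactor q N n h *
        ((∏ k ∈ Finset.Ioi j, balInt q (2 * N + 2 * ((k : ℕ) + 1) - 2 * h)) *
          ∏ r ∈ Finset.Iio j, balInt q (2 * h - ((r : ℕ) + 1))) := by
  rcases lt_or_ge (2 * h - 1) (j : ℕ) with hj | hj
  · rw [pathGF_of_neg _ (by lia), Finset.prod_eq_zero (s := Finset.Iio j)
      (i := ⟨2 * h - 1, by lia⟩) (Finset.mem_Iio.2 hj), mul_zero, mul_zero]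
    rw [← balInt_zero (q := q)]
    exact congrArg _ (by simp only; lia)
  rcases lt_or_ge (N + j + 1) h with hA | hA
  · rw [pathGF_eq_zero (by lia) (by lia) ⟨N + h - 1, by lia⟩,
      Finset.prod_eq_zero (s := Finset.Ioi j) (i := ⟨h - N - 1, by lia⟩)
      (Finset.mem_Ioi.2 (by rw [Fin.lt_def]; simp only; lia)), zero_mul, mul_zero]
    rw [← balInt_zero (q := q)]
    exact congrArg _ (by simp only; lia)
  obtain ⟨A, hA⟩ : ∃ A, A + h = N + j + 1 := ⟨N + j + 1 - h, by lia⟩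
  obtain ⟨b, hb⟩ : ∃ b, b + j + 1 = 2 * h := ⟨2 * h - 1 - j, by lia⟩
  have even_ne := evenFact_ne_zero hq hq_int (N + n - h)
  have fact_ne := balFact_ne_zero hq hq_int (2 * h - 1)
  have closed_form := pathGF_eq_evenFact_div h_two hq hq_int (show 1 ≤ A + b by lia)
  rw [show 2 * (A : ℤ) + b - 1 = 2 * N + j by lia, show 2 * (A : ℤ) + b = 2 * N + j + 1 by lia,
    show (b : ℤ) = 2 * h - 1 - j by lia, show A + b - 1 = N + h - 1 by lia] at closed_form
  have two_pow : (2 : K) ^ (2 * h - 1) = 2 ^ b * 2 ^ (j : ℕ) := by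
    rw [← pow_add]
    congr 1
    lia
  rw [evenFact_eq_mul_prod_Ioi hA] at even_ne
  rw [balFact_eq_mul_prod_Iio hb] at fact_ne
  rw [closed_form, bumpFactor, evenFact_eq_mul_prod_Ioi hA, balFact_eq_mul_prod_Iio hb, two_pow]
  obtain ⟨hA_ne, hP_ne⟩ := mul_ne_zero_iff.1 even_ne
  obtain ⟨hb_ne, hR_ne⟩ := mul_ne_zero_iff.1 fact_ne
  field_simp

theorem prod_balInt_triangle (N n : ℕ) :
    (∏ j : Fin n, balInt q (2 * N + j + 1)) *
        ∏ k : Fin n, ∏ r ∈ Finset.Iio k, balInt q (2 * N + 2 * ((k : ℕ) + 1) - ((r : ℕ) + 1)) =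
      ∏ k ∈ Finset.range n, ∏ l ∈ Finset.range (k + 1), balInt q (2 * N + k + l + 1) := by
  rw [← Finset.prod_mul_distrib, ← Fin.prod_univ_eq_prod_range]
  refine Finset.prod_congr rfl fun k _ => ?_
  rw [prod_Iio_eq_prod_range k fun r => balInt q (2 * N + 2 * ((k : ℕ) + 1) - ((r : ℤ) + 1)),
    Finset.prod_range_succ', mul_comm, ← Finset.prod_range_reflect]
  congr 1
  · refine Finset.prod_congr rfl fun r hr => congrArg _ ?_
    rw [Finset.mem_range] at hr
    lia

theorem tilingGF_typeCRegion_eq_typeCProduct (h_two : (2 : K) ≠ 0) (hq : q ≠ 0)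
    (hq_int : ∀ k : ℕ, 1 ≤ k → qInt (q ^ 2) k ≠ 0) {x u : ℕ} (hnu : n ≤ u) (hN : N + n = x + u)
    (h_mono : StrictMono h) (h_mem : ∀ i, 1 ≤ h i ∧ h i ≤ u) :
    tilingGF q (typeCRegion x u h) = typeCProduct q N h := by
  have entry (i k : Fin n) : pathGF q (2 * N + i) (2 * h k - 1 - i) =
      2 ^ (i : ℕ) * balInt q (2 * N + i + 1) * (bumpFactor q N n (h k) *
        ((∏ j ∈ Finset.Ioi i, balInt q (2 * N + 2 * ((j : ℕ) + 1) - 2 * h k)) *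
          ∏ r ∈ Finset.Iio i, balInt q (2 * h k - ((r : ℕ) + 1)))) := by
    rw [pathGF_eq_mul_prod h_two hq hq_int i (h_mem k).1 (by have := h_mem k; lia), mul_assoc]
  have det_core := det_prod_balInt (q := q) (fun k : Fin n => 2 * N + 2 * ((k : ℤ) + 1))
    (fun r => (r : ℤ) + 1) (fun i => 2 * (h i : ℤ))
    fun i j hij => balInt_ne_zero hq hq_int (by rw [Fin.lt_def] at hij; lia)
  rw [← Matrix.det_transpose] at det_core
  rw [tilingGF_typeCRegion_eq_det h_two hq hq_int hnu hN h_mono h_mem]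
  simp only [entry]
  refine (Matrix.det_mul_column _ _).trans ?_
  refine (congrArg _ ((Matrix.det_mul_row _ _).trans (congrArg _ det_core))).trans ?_
  simp only [typeCProduct, ← prod_balInt_triangle, Finset.prod_mul_distrib, mul_sub]
  ring

end Evaluation

section QIntegerProducts

variable {K : Type*} [Field K] {q : K}

theorem prod_zpow_eq_zpow_sum {ι : Type*} (hq : q ≠ 0) (s : Finset ι) (f : ι → ℤ) :
    ∏ i ∈ s, q ^ f i = q ^ ∑ i ∈ s, f i := by
  induction s using Finset.cons_induction with
  | empty => simp
  | cons a s ha ih => rw [Finset.prod_cons, Finset.sum_cons, ih, zpow_add₀ hq]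

theorem qInt_sq_eq_of_nonneg (hq : q ≠ 0) {k : ℤ} (hk : 0 ≤ k) :
    qInt (q ^ 2) k = q ^ (k - 1) * balInt q k := by
  lift k to ℕ using hk
  exact qInt_sq_eq hq k

theorem prod_qInt_sq {ι : Type*} (hq : q ≠ 0) {s : Finset ι} {f : ι → ℤ}
    (hf : ∀ i ∈ s, 0 ≤ f i) :
    ∏ i ∈ s, qInt (q ^ 2) (f i) = q ^ (∑ i ∈ s, (f i - 1)) * ∏ i ∈ s, balInt q (f i) := by
  rw [← prod_zpow_eq_zpow_sum hq, ← Finset.prod_mul_distrib]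
  exact Finset.prod_congr rfl fun i hi => qInt_sq_eq_of_nonneg hq (hf i hi)

theorem prod_prod_qInt_sq {ι κ : Type*} (hq : q ≠ 0) {s : Finset ι} {t : ι → Finset κ}
    {f : ι → κ → ℤ} (hf : ∀ i ∈ s, ∀ j ∈ t i, 0 ≤ f i j) :
    ∏ i ∈ s, ∏ j ∈ t i, qInt (q ^ 2) (f i j) =
      q ^ (∑ i ∈ s, ∑ j ∈ t i, (f i j - 1)) * ∏ i ∈ s, ∏ j ∈ t i, balInt q (f i j) := by
  simp only [Finset.prod_sigma', Finset.sum_sigma']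
  exact prod_qInt_sq hq fun p hp => hf _ (Finset.mem_sigma.1 hp).1 _ (Finset.mem_sigma.1 hp).2

theorem prod_Icc_one_eq_prod_range {M : Type*} [CommMonoid M] (f : ℕ → M) (l : ℕ) :
    ∏ j ∈ Finset.Icc 1 l, f j = ∏ j ∈ Finset.range l, f (j + 1) := by
  rw [← Finset.Ico_succ_right_eq_Icc, Finset.prod_Ico_eq_prod_range]
  exact Finset.prod_congr rfl fun j _ => congrArg f (add_comm 1 j)

theorem prod_qFact_sq {ι : Type*} (hq : q ≠ 0) (s : Finset ι) (m : ι → ℕ) :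
    ∏ i ∈ s, qFact (q ^ 2) (m i) =
      q ^ (∑ i ∈ s, ∑ k ∈ Finset.range (m i), (k : ℤ)) * ∏ i ∈ s, balFact q (m i) := by
  have key := prod_prod_qInt_sq hq (s := s) (t := fun i => Finset.range (m i))
    (f := fun _ k => (k : ℤ) + 1) fun _ _ _ _ => by lia
  simpa only [qFact, balFact, prod_Icc_one_eq_prod_range fun k : ℕ => qInt (q ^ 2) k,
    Nat.cast_add, Nat.cast_one, add_sub_cancel_right] using key

theorem prod_triangle_regroup {M : Type*} [CommMonoid M] (n : ℕ) (f : ℕ → M) :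
    ∏ i ∈ Finset.range ((n + 1) / 2), ∏ j ∈ Finset.range (2 * n - 1 - 4 * i), f (2 * i + j) =
      ∏ k ∈ Finset.range n, ∏ l ∈ Finset.range (k + 1), f (k + l) := by
  induction n using Nat.twoStepInduction generalizing f with
  | zero => simp
  | one => simp
  | more n ih _ =>
    have first_row : ∏ j ∈ Finset.range (2 * (n + 2) - 1), f j =
        (∏ l ∈ Finset.range (n + 1), f (n + l + 2)) * ∏ k ∈ Finset.range (n + 2), f k := by
      rw [show 2 * (n + 2) - 1 = n + 2 + (n + 1) by lia, Finset.prod_range_add, mul_comm]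
      simp only [add_right_comm]
    have lower_rows : ∏ i ∈ Finset.range ((n + 1) / 2),
        ∏ j ∈ Finset.range (2 * (n + 2) - 1 - 4 * (i + 1)), f (2 * (i + 1) + j) =
          ∏ k ∈ Finset.range n, ∏ l ∈ Finset.range (k + 1), f (k + l + 2) := by
      rw [← ih fun k => f (k + 2)]
      refine Finset.prod_congr rfl fun i _ => ?_
      rw [show 2 * (n + 2) - 1 - 4 * (i + 1) = 2 * n - 1 - 4 * i by lia]
      exact Finset.prod_congr rfl fun j _ => congrArg f (by ring)
    have columns : ∏ k ∈ Finset.range (n + 2), ∏ l ∈ Finset.range (k + 1), f (k + l) =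
        (∏ k ∈ Finset.range (n + 1), ∏ l ∈ Finset.range (k + 1), f (k + l + 2)) *
          ∏ k ∈ Finset.range (n + 2), f k := by
      have row (k : ℕ) : ∏ l ∈ Finset.range (k + 1), f (k + l) =
          (∏ l ∈ Finset.range k, f (k + l + 1)) * f k := Finset.prod_range_succ' _ _
      simp only [row, Finset.prod_mul_distrib]
      rw [Finset.prod_range_succ' _ (n + 1), Finset.prod_range_zero, mul_one]
      simp only [add_right_comm]
    rw [show (n + 2 + 1) / 2 = (n + 1) / 2 + 1 by lia, Finset.prod_range_succ', lower_rows,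
      columns, Finset.prod_range_succ _ n, mul_assoc, ← first_row]
    simp only [mul_zero, zero_add, Nat.sub_zero]

theorem prod_Icc_triangle_regroup {M : Type*} [CommMonoid M] (n : ℕ) (f : ℕ → M) :
    ∏ i ∈ Finset.Icc 1 ((n + 1) / 2), ∏ j ∈ Finset.Icc 1 (2 * n + 3 - 4 * i), f (2 * i + j) =
      ∏ k ∈ Finset.range n, ∏ l ∈ Finset.range (k + 1), f (k + l + 3) := by
  rw [← prod_triangle_regroup n fun k => f (k + 3), prod_Icc_one_eq_prod_range fun i =>
    ∏ j ∈ Finset.Icc 1 (2 * n + 3 - 4 * i), f (2 * i + j)]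
  refine Finset.prod_congr rfl fun i _ => ?_
  rw [prod_Icc_one_eq_prod_range fun j => f (2 * (i + 1) + j),
    show 2 * n + 3 - 4 * (i + 1) = 2 * n - 1 - 4 * i by lia]
  exact Finset.prod_congr rfl fun j _ => congrArg f (by ring)

theorem prod_balInt_even (hq : q ≠ 0) (hq_int : ∀ k : ℕ, 1 ≤ k → qInt (q ^ 2) k ≠ 0) (m l : ℕ) :
    ∏ k ∈ Finset.range l, balInt q (2 * (m + k + 1)) = evenFact q (m + l) / evenFact q m := by
  rw [evenFact_add, mul_div_cancel_left₀ _ (evenFact_ne_zero hq hq_int m)]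

end QIntegerProducts

section Exponents

variable {n : ℕ}

theorem two_mul_sum_range_add (a : ℤ) (k : ℕ) :
    2 * ∑ l ∈ Finset.range k, (a + l) = k * (2 * a + k - 1) := by
  induction k with
  | zero => simp
  | succ k ih =>
    rw [Finset.sum_range_succ, mul_add, ih]
    push_cast
    ring

theorem consecSum_eq_sum_range (a : ℤ) (k : ℕ) :
    consecSum (a + k - 1) a = ∑ l ∈ Finset.range k, (a + l) := by
  rw [consecSum, Int.Icc_eq_finset_map, Finset.sum_map, show (a + k - 1 + 1 - a).toNat = k by lia]
  rfl

theorem sum_sum_Ioi_sub (f : Fin n → ℤ) :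
    ∑ i, ∑ j ∈ Finset.Ioi i, (f j - f i) = ∑ i : Fin n, (2 * i + 1 - n) * f i := by
  have swap : ∑ i, ∑ j ∈ Finset.Ioi i, f j = ∑ j, ∑ _i ∈ Finset.Iio j, f j :=
    Finset.sum_comm' (by simp)
  simp only [Finset.sum_sub_distrib, swap]
  simp only [Finset.sum_const, Fin.card_Iio, Fin.card_Ioi, nsmul_eq_mul, ← Finset.sum_sub_distrib]
  refine Finset.sum_congr rfl fun i _ => ?_
  rw [show ((n - 1 - i : ℕ) : ℤ) = n - 1 - i by have := i.isLt; lia]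
  ring

theorem sum_sum_Ioi_one : ∑ i : Fin n, ∑ _j ∈ Finset.Ioi i, (1 : ℤ) = ∑ i : Fin n, (i : ℤ) := by
  rw [Finset.sum_comm' (t' := Finset.univ) (s' := Finset.Iio) (by simp)]
  simp

/-- The last summand is a difference of consecutive values, so it telescopes in the sum over `i`. -/
theorem exponent_balance_term {N h i : ℕ} (hi : i + 1 ≤ h) :
    (2 * i + 1 - n) * (2 * (h : ℤ)) - i + ∑ l ∈ Finset.range (i + 1), (2 * (N : ℤ) + i + l) +
        ((h - (i + 1) : ℕ) : ℤ) * (4 * N + 2 * n - 2) =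
      consecSum (2 * N + i) (2 * N - 2 * h + 2 * (i + 1)) +
        ∑ k ∈ Finset.range (2 * h - 1), (k : ℤ) +
        (((i : ℤ) + 1) * (i + 2) * (i + 1 - n) - i * (i + 1) * (i - n)) := by
  have triangle_sum := two_mul_sum_range_add (2 * (N : ℤ) + i) (i + 1)
  have consec_sum := two_mul_sum_range_add (2 * (N : ℤ) - 2 * h + 2 * (i + 1)) (2 * h - (i + 1))
  have fact_sum := two_mul_sum_range_add 0 (2 * h - 1)
  rw [← consecSum_eq_sum_range] at consec_sum
  simp only [zero_add] at fact_sum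
  obtain ⟨d, rfl⟩ := Nat.exists_eq_add_of_le hi
  have cast_consec : ((2 * (i + 1 + d) - (i + 1) : ℕ) : ℤ) = i + 1 + 2 * d := by lia
  have cast_fact : ((2 * (i + 1 + d) - 1 : ℕ) : ℤ) = 2 * i + 1 + 2 * d := by lia
  have upper_end : 2 * (N : ℤ) - 2 * (i + 1 + d : ℕ) + 2 * (i + 1) + (i + 1 + 2 * d) - 1 =
      2 * N + i := by
    push_cast
    ring
  rw [cast_consec, upper_end] at consec_sum
  rw [cast_fact] at fact_sum
  rw [Nat.add_sub_cancel_left]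
  refine mul_left_cancel₀ (two_ne_zero' ℤ) ?_
  push_cast at *
  linear_combination triangle_sum - consec_sum - fact_sum

theorem exponent_balance (N : ℕ) {h : Fin n → ℕ} (h_le : ∀ i : Fin n, (i : ℕ) + 1 ≤ h i) :
    (∑ i, ∑ j ∈ Finset.Ioi i, (2 * ((h j : ℤ) - h i) - 1)) +
        (∑ k ∈ Finset.range n, ∑ l ∈ Finset.range (k + 1), (2 * (N : ℤ) + k + l)) +
        ∑ i : Fin n, ((h i - (i + 1) : ℕ) : ℤ) * (4 * N + 2 * n - 2) =
      (∑ i : Fin n, consecSum (2 * N + i) (2 * N - 2 * h i + 2 * (i + 1))) +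
        ∑ i, ∑ k ∈ Finset.range (2 * h i - 1), (k : ℤ) := by
  have telescope :
      ∑ i : Fin n, (((i : ℤ) + 1) * (i + 2) * (i + 1 - n) - i * (i + 1) * (i - n)) = 0 := by
    have := Finset.sum_range_sub (fun i : ℕ => (i : ℤ) * (i + 1) * (i - n)) n
    simpa [Finset.sum_range, add_assoc, one_add_one_eq_two] using this
  have pair_sum : ∑ i, ∑ j ∈ Finset.Ioi i, (2 * ((h j : ℤ) - h i) - 1) =
      ∑ i : Fin n, ((2 * i + 1 - n) * (2 * (h i : ℤ)) - i) := by
    rw [Finset.sum_sub_distrib, ← sum_sum_Ioi_sub, ← sum_sum_Ioi_one]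
    simp only [← Finset.sum_sub_distrib, mul_sub]
  rw [pair_sum, Finset.sum_range, eq_comm, ← add_zero (_ + _), ← telescope]
  simp only [← Finset.sum_add_distrib]
  exact Finset.sum_congr rfl fun i _ => (exponent_balance_term (h_le i)).symm

end Exponents

section ProductFormula

variable {K : Type*} [Field K] {q : K} {n N : ℕ} {h : Fin n → ℕ}

theorem succ_le_of_strictMono (h_mono : StrictMono h) (h_pos : ∀ i, 1 ≤ h i) (i : Fin n) :
    (i : ℕ) + 1 ≤ h i := by
  obtain ⟨i, hi⟩ := i
  induction i with
  | zero => exact h_pos _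
  | succ i ih => exact (ih (by lia)).trans_lt (h_mono (Fin.mk_lt_mk.2 i.lt_succ_self))

theorem prod_triangle_qInt_sq (hq : q ≠ 0) :
    ∏ i ∈ Finset.Icc 1 ((n + 1) / 2), ∏ j ∈ Finset.Icc 1 (2 * n + 3 - 4 * i),
        qInt (q ^ 2) (2 * ((N : ℤ) - 1) + 2 * i + j) =
      q ^ (∑ k ∈ Finset.range n, ∑ l ∈ Finset.range (k + 1), (2 * (N : ℤ) + k + l)) *
        ∏ k ∈ Finset.range n, ∏ l ∈ Finset.range (k + 1), balInt q (2 * N + k + l + 1) := by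
  have regroup := prod_Icc_triangle_regroup n fun z => qInt (q ^ 2) (2 * ((N : ℤ) - 1) + z)
  have pull_out := prod_prod_qInt_sq hq (s := Finset.range n)
    (t := fun k => Finset.range (k + 1)) (f := fun k l => 2 * (N : ℤ) + k + l + 1)
    fun _ _ _ _ => by lia
  have shift (k l : ℕ) : 2 * ((N : ℤ) - 1) + k + l + 3 = 2 * N + k + l + 1 := by ring
  simp only [add_sub_cancel_right] at pull_out
  simp only [Nat.cast_add, Nat.cast_mul, Nat.cast_ofNat, ← add_assoc, shift] at regroup
  rw [regroup, pull_out]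

theorem prod_bump_qInt_sq (hq : q ≠ 0) (hq_int : ∀ k : ℕ, 1 ≤ k → qInt (q ^ 2) k ≠ 0) {h i : ℕ}
    (hi : i + 1 ≤ h) (hN : h ≤ N + n) :
    ∏ j ∈ Finset.Icc 1 (h - (i + 1)),
        qInt (q ^ 2) (2 * ((N : ℤ) + i + j)) * qInt (q ^ 2) (2 * ((N : ℤ) + n - i - j)) =
      q ^ (((h - (i + 1) : ℕ) : ℤ) * (4 * N + 2 * n - 2)) *
        (evenFact q (N + h - 1) / evenFact q (N + n - h) *
          (evenFact q (N + n - (i + 1)) / evenFact q (N + i))) := by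
  obtain ⟨l, rfl⟩ := Nat.exists_eq_add_of_le hi
  obtain ⟨m, hm⟩ := Nat.exists_eq_add_of_le hN
  rw [Nat.add_sub_cancel_left, prod_Icc_one_eq_prod_range fun j =>
    qInt (q ^ 2) (2 * ((N : ℤ) + i + j)) * qInt (q ^ 2) (2 * ((N : ℤ) + n - i - j))]
  have lower := prod_balInt_even hq hq_int (N + i) l
  have upper := prod_balInt_even hq hq_int m l
  rw [← Finset.prod_range_reflect] at upper
  have term (j : ℕ) (hj : j ∈ Finset.range l) :
      qInt (q ^ 2) (2 * ((N : ℤ) + i + (j + 1 : ℕ))) *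
          qInt (q ^ 2) (2 * ((N : ℤ) + n - i - (j + 1 : ℕ))) =
        q ^ (4 * N + 2 * n - 2 : ℤ) * (balInt q (2 * ((N + i : ℕ) + j + 1)) *
          balInt q (2 * (m + (l - 1 - j : ℕ) + 1))) := by
    rw [Finset.mem_range] at hj
    rw [qInt_sq_eq_of_nonneg hq (by lia), qInt_sq_eq_of_nonneg hq (by lia), mul_mul_mul_comm,
      ← zpow_add₀ hq]
    congr 3 <;> lia
  rw [Finset.prod_congr rfl term, Finset.prod_mul_distrib, Finset.prod_mul_distrib, lower, upper,
    Finset.prod_const, Finset.card_range, ← zpow_natCast, ← zpow_mul, mul_comm (l : ℤ),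
    show N + (i + 1 + l) - 1 = N + i + l by lia, show N + n - (i + 1 + l) = m by lia,
    show N + n - (i + 1) = m + l by lia]
  ring

theorem prod_bumpFactor (h_two : (2 : K) ≠ 0) (h_pos : ∀ i, 1 ≤ h i) :
    ∏ k : Fin n, 2 ^ (k : ℕ) * bumpFactor q N n (h k) =
      2 ^ (-expF (![] : Fin 0 → ℕ) h) *
        (∏ k, evenFact q (N + h k - 1) / evenFact q (N + n - h k)) /
          ∏ k, balFact q (2 * h k - 1) := by
  have two_pow (k : Fin n) :
      (2 : K) ^ (k : ℕ) / 2 ^ (2 * h k - 1) = 2 ^ (-(2 * (h k : ℤ) - (k + 1))) := by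
    rw [← zpow_natCast, ← zpow_natCast, ← zpow_sub₀ h_two]
    congr 1
    have := h_pos k
    lia
  have expF_eq : -expF (![] : Fin 0 → ℕ) h = ∑ k : Fin n, -(2 * (h k : ℤ) - (k + 1)) := by
    simp [expF]
  rw [expF_eq, ← prod_zpow_eq_zpow_sum h_two, ← Finset.prod_mul_distrib, ← Finset.prod_div_distrib]
  refine Finset.prod_congr rfl fun k _ => ?_
  rw [← two_pow, bumpFactor]
  ring

theorem prod_prod_bump_qInt_sq (hq : q ≠ 0) (hq_int : ∀ k : ℕ, 1 ≤ k → qInt (q ^ 2) k ≠ 0)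
    (h_le : ∀ i : Fin n, (i : ℕ) + 1 ≤ h i) (hN : ∀ i, h i ≤ N + n) :
    ∏ i : Fin n, ∏ j ∈ Finset.Icc 1 (h i - (i + 1)),
        qInt (q ^ 2) (2 * ((N : ℤ) + i + j)) * qInt (q ^ 2) (2 * ((N : ℤ) + n - i - j)) =
      q ^ (∑ i : Fin n, ((h i - (i + 1) : ℕ) : ℤ) * (4 * N + 2 * n - 2)) *
        ∏ i, evenFact q (N + h i - 1) / evenFact q (N + n - h i) := by
  have even_ne : ∏ i : Fin n, evenFact q (N + i) ≠ 0 :=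
    Finset.prod_ne_zero_iff.2 fun i _ => evenFact_ne_zero hq hq_int _
  have reflect : ∏ i : Fin n, evenFact q (N + n - (i + 1)) = ∏ i : Fin n, evenFact q (N + i) := by
    rw [← Equiv.prod_comp Fin.revPerm]
    refine Finset.prod_congr rfl fun i _ => congrArg _ ?_
    rw [Fin.revPerm_apply, Fin.val_rev]
    lia
  rw [Finset.prod_congr rfl fun i _ => prod_bump_qInt_sq hq hq_int (h_le i) (hN i),
    Finset.prod_mul_distrib, prod_zpow_eq_zpow_sum hq, Finset.prod_mul_distrib,
    Finset.prod_div_distrib (f := fun i : Fin n => evenFact q (N + n - (i + 1))), reflect,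
    div_self even_ne, mul_one]

theorem expE_nil {X : ℤ} {u : ℕ} (hX : X + u - n - eQ u 0 0 n = N - 1) :
    expE X u 0 (![] : Fin 0 → ℕ) h =
      ∑ i : Fin n, consecSum (2 * N + i) (2 * N - 2 * h i + 2 * (i + 1)) := by
  simp only [expE, fQ, Finset.univ_eq_empty, Finset.sum_empty, Nat.cast_zero, mul_zero,
    zero_mul, Int.zero_ediv, zero_add]
  refine Finset.sum_congr rfl fun i _ => ?_
  congr 1 <;> lia

theorem qProductQ_nil {X : ℤ} {u : ℕ} (hX : X + u - n - eQ u 0 0 n = N - 1) :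
    qProductQ q X u 0 ![] h =
      2 ^ (-expF (![] : Fin 0 → ℕ) h) *
        q ^ (-∑ i : Fin n, consecSum (2 * N + i) (2 * N - 2 * h i + 2 * (i + 1))) *
        ((∏ i, ∏ j ∈ Finset.Ioi i, qInt (q ^ 2) (2 * ((h j : ℤ) - h i))) /
          ∏ j, qFact (q ^ 2) (2 * h j - 1)) *
        (∏ i ∈ Finset.Icc 1 ((n + 1) / 2), ∏ j ∈ Finset.Icc 1 (2 * n + 3 - 4 * i),
          qInt (q ^ 2) (2 * ((N : ℤ) - 1) + 2 * i + j)) *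
        ∏ i : Fin n, ∏ j ∈ Finset.Icc 1 (h i - (i + 1)),
          qInt (q ^ 2) (2 * ((N : ℤ) + i + j)) * qInt (q ^ 2) (2 * ((N : ℤ) + n - i - j)) := by
  have lower (i : Fin n) (j : ℕ) : (N : ℤ) - 1 + (i + 1) + j = N + i + j := by ring
  have upper (i : Fin n) (j : ℕ) : (N : ℤ) - 1 - (i + 1) - j + n + 2 = N + n - i - j := by ring
  simp only [qProductQ, expE_nil hX, Nat.cast_zero, add_zero, sub_zero, hX, lower, upper,
    Finset.univ_eq_empty, Finset.prod_empty, Finset.prod_const_one, one_mul, mul_one,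
    Finset.Icc_eq_empty_of_lt Nat.zero_lt_one]

theorem qProductQ_eq_typeCProduct (h_two : (2 : K) ≠ 0) (hq : q ≠ 0)
    (hq_int : ∀ k : ℕ, 1 ≤ k → qInt (q ^ 2) k ≠ 0) {X : ℤ} {u : ℕ}
    (hX : X + u - n - eQ u 0 0 n = N - 1) (h_mono : StrictMono h) (h_pos : ∀ i, 1 ≤ h i)
    (hN : ∀ i, h i ≤ N + n) :
    qProductQ q X u 0 ![] h = typeCProduct q N h := by
  have h_le := succ_le_of_strictMono h_mono h_pos
  have pairs := prod_prod_qInt_sq hq (s := Finset.univ) (t := Finset.Ioi)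
    (f := fun i j => 2 * ((h j : ℤ) - h i)) fun i _ j hj => by
      have := h_mono (Finset.mem_Ioi.1 hj)
      lia
  have balance := congrArg (q ^ ·) (exponent_balance N h_le)
  simp only [zpow_add₀ hq] at balance
  replace balance :=
    (div_eq_one_iff_eq (mul_ne_zero (zpow_ne_zero _ hq) (zpow_ne_zero _ hq))).2 balance
  rw [← one_mul (typeCProduct q N h), ← balance, qProductQ_nil hX, typeCProduct,
    prod_bumpFactor h_two h_pos, pairs, prod_qFact_sq hq, prod_triangle_qInt_sq hq,
    prod_prod_bump_qInt_sq hq hq_int h_le hN, zpow_neg q]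
  ring

end ProductFormula

theorem mainTheorem9 {K : Type*} [Field K] (q : K) (h_two : (2 : K) ≠ 0) (hq : q ≠ 0)
    (hq_int : ∀ k : ℕ, 1 ≤ k → qInt (q ^ 2) k ≠ 0)
    (x u n : ℕ) (hnu : n ≤ u) (h : Fin n → ℕ) (h_mono : StrictMono h)
    (h_mem : ∀ i, 1 ≤ h i ∧ h i ≤ u) :
    (n < u → tilingGF q (typeCRegion x u h) = qProductQ q x u 0 ![] h) ∧
    (n = u → tilingGF q (typeCRegion x u h) = qProductQ q ((x : ℤ) - 1) u 0 ![] h) := by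
  obtain ⟨N, hN⟩ : ∃ N, N + n = x + u := ⟨x + u - n, by lia⟩
  have h_pos (i : Fin n) : 1 ≤ h i := (h_mem i).1
  have h_le (i : Fin n) : h i ≤ N + n := by have := (h_mem i).2; lia
  rw [tilingGF_typeCRegion_eq_typeCProduct h_two hq hq_int hnu hN h_mono h_mem]
  constructor <;> intro hn <;>
    refine (qProductQ_eq_typeCProduct h_two hq hq_int ?_ h_mono h_pos h_le).symm
  · rw [eQ, min_eq_right (by lia)]
    lia
  · rw [eQ, min_eq_left (by lia)]
    lia
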